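/- Let $n,w\ge 0$ be integers. All homology is with integer coefficients. \emph{The complex $\mathrm{cel}(A,w)$.} For a finite set $A$, a \emph{symbol} on $A$ is an ordering of the elements of $A$ cut into nonempty ordered blocks; a symbol with $r$ blocks is a cell of $\mathrm{cel}(A)$ of dimension $|A|-r$. Its facets are obtained by replacing a block $l$ by two nonempty blocks $a\mid b$ of which $l$ is a shuffle. The cellular chain complex of $\mathrm{cel}(A)$ has boundary operator determined as follows: for a one-block symbol $l$, the coefficient of $a\mid b$ in $\partial l$ is $(-1)^{\mathrm{length}(a)}\operatorname{sgn}(l\mapsto ab)$, and in general $\partial(f\mid g)=\partial f\mid g+(-1)^{\dim f}f\mid\partial g$. The subcomplex $\mathrm{cel}(A,w)$ consists of the symbols all of whose blocks have at most $w$ elements; $\mathrm{cel}(n,w)=\mathrm{cel}(\{1,\dots,n\},w)$. \emph{The complex $P(m,\mathcal W,w)$.} The cells of the permutohedron $P(m)$ are the ordered partitions of $\{1,\dots,m\}$ into nonempty blocks (unordered inside). Writing each block in increasing order embeds $P(m)$ as a subcomplex of $\mathrm{cel}(m)$, from which it gets its chain complex. For weights $\mathcal W\in\mathbb N^m$, $P(m,\mathcal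 W,w)$ is the subcomplex of the cells each of whose blocks has total weight at most $w$. \emph{Wheels and layers.} Write $\sigma\in S_n$ as a word $\sigma(1)\cdots\sigma(n)$ and cut it before every entry that is larger than all preceding ones; the pieces are the \emph{wheels} of $\sigma$. Let $\#\sigma$ be $n$ minus the number of wheels, and let $\mathcal W(\sigma)$ be the list of the cardinalities of the $n-\#\sigma$ wheels, in order. In $\mathrm{cel}(n,w)$, let $L(\le\sigma)$ (resp. $L(<\sigma)$) be the subcomplex of all cells contained in a top-dimensional cell $\tau$ of $\mathrm{cel}(n)$ for some permutation $\tau$ lexicographically $\le\sigma$ (resp. $<\sigma$); a symbol is contained in the top-dimensional cell $\tau$ if $\tau$ contains each of its blocks as a subword. \emph{Spinning.} Spinning a wheel $v_1\cdots v_k$ means starting from the word $v_1$ and successively placing $v_2,\dots,v_k$ each either at the end or at the front of the word obtained so far; a front placement of an element before a word $u$ contributes the sign $(-1)^{\mathrm{length}(u)+1}$. For a cell $c$ of $P(n-\#\sigma)$, whose labels are identified with the wheels of $\sigma$ in order, let $\mathrm{spin}_\sigma(c)$ be the signed sum of the $2^{\#\sigma}$ symbols obtained by replacing, in each block of $c$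 written in increasing order, every label by its wheel spun in one of the possible ways. \textbf{Theorem.} For every $j$, \[H_j(\mathrm{cel}(n,w))\;\cong\;\bigoplus_{\sigma\in S_n}H_{j-\#\sigma}\bigl(P(n-\#\sigma,\mathcal W(\sigma),w)\bigr).\] More precisely, for every $\sigma\in S_n$ there is an injective chain map \[i_\sigma:C_{*-\#\sigma}\bigl(P(n-\#\sigma,\mathcal W(\sigma),w)\bigr)\to C_*(L(\le\sigma)),\qquad i_\sigma(c)=\pm\,\mathrm{spin}_\sigma(c)\ \text{for every cell } c,\] the sign depending on the cell, such that: (a) for every $\sigma$ and $j$, the inclusion $L(<\sigma)\subseteq L(\le\sigma)$ and $i_\sigma$ induce an isomorphism \[H_j(L(<\sigma))\oplus H_{j-\#\sigma}\bigl(P(n-\#\sigma,\mathcal W(\sigma),w)\bigr)\to H_j(L(\le\sigma));\] (b) for every $j$, the maps $i_\sigma$, followed by the inclusions $L(\le\sigma)\subseteq\mathrm{cel}(n,w)$, induce an isomorphism \[\bigoplus_{\sigma\in S_n}H_{j-\#\sigma}\bigl(P(n-\#\sigma,\mathcal W(\sigma),w)\bigr)\to H_j(\mathrm{cel}(n,w)).\]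 -/

import Mathlib

open CategoryTheory
open scoped DirectSum

noncomputable section

namespace StripCell

/-! ### Symbols, shuffles and the boundary operator

A cell of `cel(A)` is represented by its symbol, a list of blocks, each block being a list of
elements of `A`. -/

section Symbols

variable {A : Type}

/-- A symbol on `A`: an ordering of the elements of `A`, each occurring once, cut into nonempty
blocks. -/
def IsSymbol (f : List (List A)) : Prop :=
  (∀ b ∈ f, b ≠ []) ∧ f.flatten.Nodup ∧ ∀ x : A, x ∈ f.flatten

/-- A symbol on `A` with `r` blocks is a cell of dimension `|A| - r`. -/
def cellDim [Fintype A] (f : List (List A)) : ℤ := (Fintype.card A : ℤ) - f.length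

/-- All triples `(s, a, b)` such that the word `l` is a shuffle of the word `a` and the word `b`
(`b` occupying the positions complementary to those of `a`), with `s = ±1` the sign of the
permutation `l ↦ a b`. -/
def deshuffles : List A → List (ℤ × List A × List A)
  | [] => [(1, [], [])]
  | x :: l => (deshuffles l).flatMap fun t =>
      [(t.1, x :: t.2.1, t.2.2), ((-1) ^ t.2.1.length * t.1, t.2.1, x :: t.2.2)]

/-- `g` is a facet of `f`: some block `l` of `f`, a shuffle of nonempty words `a` and `b`,
is replaced by the two blocks `a | b`. -/
def IsFacet (g f : List (List A)) : Prop :=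
  ∃ (p q : List (List A)) (l a b : List A) (s : ℤ), (s, a, b) ∈ deshuffles l ∧ a ≠ [] ∧ b ≠ [] ∧
    f = p ++ l :: q ∧ g = p ++ a :: b :: q

/-- The boundary of a one-block symbol `l`: the coefficient of `a | b` is
`(-1) ^ length a * sgn (l ↦ a b)`. -/
def blockBoundary (l : List A) : List (List A) →₀ ℤ :=
  (((deshuffles l).filter fun t => !t.2.1.isEmpty && !t.2.2.isEmpty).map fun t =>
    Finsupp.single [t.2.1, t.2.2] ((-1) ^ t.2.1.length * t.1)).sum

/-- The boundary of a symbol, by the Leibniz rule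
`∂ (l | f) = ∂ l | f + (-1) ^ (length l - 1) l | ∂ f`
(the exponent is written `length l + 1`, which has the same parity). -/
def cellBoundary : List (List A) → (List (List A) →₀ ℤ)
  | [] => 0
  | l :: f => (blockBoundary l).mapDomain (fun u => u ++ f) +
      (-1 : ℤ) ^ (l.length + 1) • (cellBoundary f).mapDomain (fun u => l :: u)

/-- The linear extension of `cellBoundary` to formal sums of symbols. -/
def boundary (A : Type) : (List (List A) →₀ ℤ) →ₗ[ℤ] (List (List A) →₀ ℤ) :=
  Finsupp.linearCombination ℤ cellBoundary

theorem deshuffles_length {l a b : List A} {s : ℤ} (h : (s, a, b) ∈ deshuffles l) :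
    a.length + b.length = l.length := by
  induction l generalizing s a b with
  | nil => simp [deshuffles] at h; simp [h]
  | cons x l ih =>
    simp only [deshuffles, List.mem_flatMap, List.mem_cons, List.not_mem_nil, or_false,
      Prod.mk.injEq] at h
    obtain ⟨⟨s', a', b'⟩, ht, ⟨rfl, rfl, rfl⟩ | ⟨rfl, rfl, rfl⟩⟩ := h
    · have := ih ht; simp; omega
    · have := ih ht; simp; omega

theorem deshuffles_perm {l a b : List A} {s : ℤ} (h : (s, a, b) ∈ deshuffles l) :
    (a ++ b).Perm l := by
  induction l generalizing s a b with
  | nil => simp [deshuffles] at h; simp [h]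
  | cons x l ih =>
    simp only [deshuffles, List.mem_flatMap, List.mem_cons, List.not_mem_nil, or_false,
      Prod.mk.injEq] at h
    obtain ⟨⟨s', a', b'⟩, ht, ⟨rfl, rfl, rfl⟩ | ⟨rfl, rfl, rfl⟩⟩ := h
    · exact (ih ht).cons x
    · exact List.perm_middle.trans ((ih ht).cons x)

theorem deshuffles_sublist {l a b : List A} {s : ℤ} (h : (s, a, b) ∈ deshuffles l) :
    a.Sublist l ∧ b.Sublist l := by
  induction l generalizing s a b with
  | nil => simp [deshuffles] at h; simp [h]
  | cons x l ih =>
    simp only [deshuffles, List.mem_flatMap, List.mem_cons, List.not_mem_nil, or_false,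
      Prod.mk.injEq] at h
    obtain ⟨⟨s', a', b'⟩, ht, ⟨rfl, rfl, rfl⟩ | ⟨rfl, rfl, rfl⟩⟩ := h
    · exact ⟨(ih ht).1.cons_cons x, (ih ht).2.cons x⟩
    · exact ⟨(ih ht).1.cons x, (ih ht).2.cons_cons x⟩

theorem IsFacet.length {g f : List (List A)} (h : IsFacet g f) : g.length = f.length + 1 := by
  obtain ⟨p, q, l, a, b, s, -, -, -, rfl, rfl⟩ := h
  simp; omega

theorem IsFacet.isSymbol {g f : List (List A)} (h : IsFacet g f) (hf : IsSymbol f) :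
    IsSymbol g := by
  obtain ⟨p, q, l, a, b, s, hs, ha, hb, rfl, rfl⟩ := h
  have hp : (p ++ a :: b :: q).flatten.Perm (p ++ l :: q).flatten := by
    simp only [List.flatten_append, List.flatten_cons]
    refine List.Perm.append_left _ ?_
    rw [← List.append_assoc]
    exact (deshuffles_perm hs).append_right _
  refine ⟨?_, hp.nodup_iff.2 hf.2.1, fun x => hp.mem_iff.2 (hf.2.2 x)⟩
  intro c hc
  simp only [List.mem_append, List.mem_cons] at hc
  rcases hc with hc | rfl | rfl | hc
  · exact hf.1 c (by simp [hc])
  · exact ha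
  · exact hb
  · exact hf.1 c (by simp [hc])

theorem IsFacet.forall_sublist {g f : List (List A)} (h : IsFacet g f) {b : List A}
    (hb : b ∈ g) : ∃ c ∈ f, b.Sublist c := by
  obtain ⟨p, q, l, a, b', s, hs, -, -, rfl, rfl⟩ := h
  simp only [List.mem_append, List.mem_cons] at hb
  rcases hb with hc | rfl | rfl | hc
  · exact ⟨b, by simp [hc], List.Sublist.refl _⟩
  · exact ⟨l, by simp, (deshuffles_sublist hs).1⟩
  · exact ⟨l, by simp, (deshuffles_sublist hs).2⟩
  · exact ⟨b, by simp [hc], List.Sublist.refl _⟩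

/-- Signed sums over the deshuffles of a word. -/
def deshuffleSum {M : Type} [AddCommGroup M] (l : List A) (F : List A → List A → M) : M :=
  ((deshuffles l).map fun t => t.1 • F t.2.1 t.2.2).sum

theorem deshuffleSum_congr {M : Type} [AddCommGroup M] {l : List A} {F G : List A → List A → M}
    (h : ∀ a b, a.length + b.length = l.length → F a b = G a b) :
    deshuffleSum l F = deshuffleSum l G := by
  unfold deshuffleSum
  congr 1
  refine List.map_congr_left ?_
  rintro ⟨s, a, b⟩ ht
  rw [h a b (deshuffles_length ht)]

theorem deshuffleSum_cons {M : Type} [AddCommGroup M] (x : A) (l : List A)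
    (F : List A → List A → M) :
    deshuffleSum (x :: l) F = deshuffleSum l (fun a b => F (x :: a) b) +
      deshuffleSum l (fun a b => (-1 : ℤ) ^ a.length • F a (x :: b)) := by
  unfold deshuffleSum
  rw [deshuffles]
  generalize deshuffles l = L
  induction L with
  | nil => simp
  | cons t L ih =>
    simp only [List.flatMap_cons, List.map_append, List.sum_append, ih, List.map_cons,
      List.sum_cons, List.map_nil, List.sum_nil, smul_smul]
    rw [mul_comm t.1]
    abel

theorem deshuffleSum_add {M : Type} [AddCommGroup M] (l : List A) (F G : List A → List A → M) :
    deshuffleSum l (fun a b => F a b + G a b) = deshuffleSum l F + deshuffleSum l G := by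
  unfold deshuffleSum
  simp [smul_add, List.sum_map_add]

theorem map_deshuffleSum {M N : Type} [AddCommGroup M] [AddCommGroup N] (φ : M →ₗ[ℤ] N)
    (l : List A) (F : List A → List A → M) :
    φ (deshuffleSum l F) = deshuffleSum l (fun a b => φ (F a b)) := by
  unfold deshuffleSum
  rw [map_list_sum, List.map_map]
  congr 1
  refine List.map_congr_left fun t _ => ?_
  simp

theorem smul_deshuffleSum {M : Type} [AddCommGroup M] (c : ℤ) (l : List A)
    (F : List A → List A → M) :
    c • deshuffleSum l F = deshuffleSum l (fun a b => c • F a b) :=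
  map_deshuffleSum (LinearMap.lsmul ℤ M c) l F

theorem deshuffleSum_assoc {M : Type} [AddCommGroup M] (l : List A)
    (G : List A → List A → List A → M) :
    deshuffleSum l (fun u c => deshuffleSum u fun a b => G a b c) =
      deshuffleSum l (fun a v => deshuffleSum v fun b c => G a b c) := by
  induction l generalizing G with
  | nil => simp [deshuffleSum, deshuffles]
  | cons x l ih =>
    simp only [deshuffleSum_cons, deshuffleSum_add, smul_add]
    rw [ih (fun a b c => G (x :: a) b c), add_assoc]
    congr 1
    rw [ih (fun a b c => (-1 : ℤ) ^ a.length • G a (x :: b) c)]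
    have e : deshuffleSum l (fun u c => (-1 : ℤ) ^ u.length •
          deshuffleSum u fun a b => G a b (x :: c)) =
        deshuffleSum l (fun a v => deshuffleSum v fun b c =>
          (-1 : ℤ) ^ (a.length + b.length) • G a b (x :: c)) := by
      rw [← ih (fun a b c => (-1 : ℤ) ^ (a.length + b.length) • G a b (x :: c))]
      refine deshuffleSum_congr fun u c _ => ?_
      rw [smul_deshuffleSum]
      exact deshuffleSum_congr fun a b h => by rw [h]
    rw [e]
    congr 1
    · exact deshuffleSum_congr fun a v _ => (smul_deshuffleSum _ _ _).symm
    · refine deshuffleSum_congr fun a v _ => ?_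
      rw [smul_deshuffleSum]
      refine deshuffleSum_congr fun b c _ => ?_
      rw [smul_smul, pow_add]

open Classical in
theorem blockBoundary_eq (l : List A) :
    blockBoundary l = deshuffleSum l (fun a b => if a = [] ∨ b = [] then 0 else
      Finsupp.single [a, b] ((-1) ^ a.length)) := by
  unfold blockBoundary deshuffleSum
  generalize deshuffles l = L
  induction L with
  | nil => simp
  | cons t L ih =>
    obtain ⟨s, a, b⟩ := t
    rw [List.map_cons, List.sum_cons, ← ih]
    rcases a with _ | ⟨x, a⟩ <;> rcases b with _ | ⟨y, b⟩ <;> simp [mul_comm]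

theorem deshuffleSum_zero {M : Type} [AddCommGroup M] (l : List A) :
    deshuffleSum l (fun _ _ => (0 : M)) = 0 := by
  simp [deshuffleSum]

theorem deshuffleSum_neg {M : Type} [AddCommGroup M] (l : List A) (F : List A → List A → M) :
    deshuffleSum l (fun a b => - F a b) = - deshuffleSum l F := by
  have := deshuffleSum_add l F (fun a b => - F a b)
  simp only [add_neg_cancel, deshuffleSum_zero] at this
  exact eq_neg_of_add_eq_zero_right this.symm

open Classical in
theorem map_blockBoundary {N : Type} [AddCommGroup N] (φ : (List (List A) →₀ ℤ) →ₗ[ℤ] N)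
    (l : List A) :
    φ (blockBoundary l) = deshuffleSum l (fun a b => if a = [] ∨ b = [] then 0 else
      (-1 : ℤ) ^ a.length • φ (Finsupp.single [a, b] 1)) := by
  rw [blockBoundary_eq, map_deshuffleSum]
  refine deshuffleSum_congr fun a b _ => ?_
  split_ifs
  · simp
  · rw [← map_smul]; simp

open Classical in
theorem deshuffleSum_coassoc (l : List A) :
    deshuffleSum l (fun u c => if u = [] ∨ c = [] then (0 : List (List A) →₀ ℤ) else
      (-1 : ℤ) ^ u.length • ((blockBoundary u).mapDomain (fun v => v ++ [c]) +
        (-1 : ℤ) ^ (u.length + 1) • (blockBoundary c).mapDomain (fun v => u :: v))) = 0 := by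
  let T : List A → List A → List A → (List (List A) →₀ ℤ) := fun a b c =>
    if a = [] ∨ b = [] ∨ c = [] then 0 else (-1 : ℤ) ^ b.length • Finsupp.single [a, b, c] 1
  have h : deshuffleSum l (fun u c => deshuffleSum u fun a b => T a b c) +
      - deshuffleSum l (fun a v => deshuffleSum v fun b c => T a b c) = 0 := by
    rw [deshuffleSum_assoc]; simp
  rw [← deshuffleSum_neg, ← deshuffleSum_add] at h
  refine Eq.trans (deshuffleSum_congr fun u c _ => ?_) h
  by_cases hu : u = []
  · subst hu; simp [T, deshuffleSum, deshuffles]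
  by_cases hc : c = []
  · subst hc; simp [T, deshuffleSum, deshuffles]
  rw [if_neg (by tauto), smul_add]
  have e1 := map_blockBoundary (Finsupp.lmapDomain ℤ ℤ (fun v => v ++ [c])) u
  have e2 := map_blockBoundary (Finsupp.lmapDomain ℤ ℤ (fun v => u :: v)) c
  simp only [Finsupp.lmapDomain_apply] at e1 e2
  rw [e1, e2, smul_deshuffleSum, smul_deshuffleSum, smul_deshuffleSum, ← deshuffleSum_neg]
  congr 1
  · refine deshuffleSum_congr fun a b hab => ?_
    simp only [T, hc, or_false]
    split_ifs
    · simp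
    · rw [smul_smul, Finsupp.mapDomain_single, ← hab, ← pow_add]
      have : (-1 : ℤ) ^ (a.length + b.length + a.length) = (-1) ^ b.length := by
        rw [add_right_comm, ← two_mul, pow_add, pow_mul]; simp
      rw [this]; rfl
  · refine deshuffleSum_congr fun a b _ => ?_
    simp only [T, hu, false_or]
    split_ifs
    · simp
    · rw [smul_smul, smul_smul, Finsupp.mapDomain_single, ← neg_smul]
      congr 1
      have : (-1 : ℤ) ^ u.length * (-1) ^ u.length = 1 := by
        rw [← mul_pow]; simp
      rw [pow_succ]
      linear_combination (-(-1 : ℤ) ^ a.length) * this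

@[simp]
theorem boundary_single (f : List (List A)) (c : ℤ) :
    boundary A (Finsupp.single f c) = c • cellBoundary f := by
  simp [boundary]

/-- `blockBoundary l`, followed by each term of a formal sum of symbols. -/
def blockBoundaryMul (l : List A) : (List (List A) →₀ ℤ) →ₗ[ℤ] (List (List A) →₀ ℤ) :=
  Finsupp.linearCombination ℤ fun f => (blockBoundary l).mapDomain fun u => u ++ f

theorem boundary_cons (l : List A) (x : List (List A) →₀ ℤ) :
    boundary A (x.mapDomain fun u => l :: u) = blockBoundaryMul l x +
      (-1 : ℤ) ^ (l.length + 1) • (boundary A x).mapDomain fun u => l :: u := by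
  induction x using Finsupp.induction_linear with
  | zero => simp
  | add x y hx hy =>
    rw [Finsupp.mapDomain_add, map_add, hx, hy, map_add, map_add, Finsupp.mapDomain_add, smul_add]
    abel
  | single f c =>
    simp only [Finsupp.mapDomain_single, boundary_single, cellBoundary, blockBoundaryMul,
      Finsupp.linearCombination_single, smul_add, Finsupp.mapDomain_smul]
    rw [smul_comm c]

open Classical in
theorem blockBoundaryMul_eq (l : List A) (x : List (List A) →₀ ℤ) :
    blockBoundaryMul l x = deshuffleSum l (fun a b => if a = [] ∨ b = [] then 0 else
      (-1 : ℤ) ^ a.length • x.mapDomain fun u => a :: b :: u) := by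
  induction x using Finsupp.induction_linear with
  | zero => simp [deshuffleSum_zero]
  | add x y hx hy =>
    rw [map_add, hx, hy, ← deshuffleSum_add]
    refine deshuffleSum_congr fun a b _ => ?_
    split_ifs
    · simp
    · rw [Finsupp.mapDomain_add, smul_add]
  | single f c =>
    have e := map_blockBoundary (Finsupp.lmapDomain ℤ ℤ (fun v => v ++ f)) l
    simp only [Finsupp.lmapDomain_apply] at e
    rw [blockBoundaryMul, Finsupp.linearCombination_single, e, smul_deshuffleSum]
    refine deshuffleSum_congr fun a b _ => ?_
    split_ifs
    · simp
    · rw [smul_comm, Finsupp.mapDomain_single, Finsupp.mapDomain_single]; simp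

theorem boundary_cellBoundary (f : List (List A)) : boundary A (cellBoundary f) = 0 := by
  classical
  induction f with
  | nil => simp [cellBoundary]
  | cons l f ih =>
    have e := map_blockBoundary (boundary A ∘ₗ Finsupp.lmapDomain ℤ ℤ (fun v => v ++ f)) l
    simp only [LinearMap.comp_apply, Finsupp.lmapDomain_apply, Finsupp.mapDomain_single,
      boundary_single, one_smul, List.cons_append, List.nil_append] at e
    have h0 := congrArg (Finsupp.lmapDomain ℤ ℤ (fun v => v ++ f)) (deshuffleSum_coassoc l)
    rw [map_deshuffleSum, map_zero] at h0
    rw [cellBoundary, map_add, map_smul, e, boundary_cons, ih, Finsupp.mapDomain_zero, smul_zero,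
      add_zero, blockBoundaryMul_eq, smul_deshuffleSum, ← deshuffleSum_add]
    refine Eq.trans (deshuffleSum_congr fun a b hab => ?_) h0
    split_ifs
    · simp
    · simp only [cellBoundary, Finsupp.lmapDomain_apply, Finsupp.mapDomain_smul,
        Finsupp.mapDomain_add, smul_add, ← Finsupp.mapDomain_comp, Function.comp_def,
        List.append_assoc, List.cons_append, List.nil_append, smul_smul]
      rw [← hab]
      have key : (-1 : ℤ) ^ a.length * ((-1) ^ (a.length + 1) * (-1) ^ (b.length + 1)) +
          (-1) ^ (a.length + b.length + 1) * (-1) ^ a.length = 0 := by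
        simp only [pow_add, pow_one]; ring
      rw [add_assoc, add_assoc, ← add_smul, key, zero_smul, add_zero]

theorem boundary_boundary (x : List (List A) →₀ ℤ) : boundary A (boundary A x) = 0 := by
  induction x using Finsupp.induction_linear with
  | zero => simp
  | add x y hx hy => simp [hx, hy]
  | single f c => simp [boundary_cellBoundary]

theorem isFacet_of_mem_support (f g : List (List A)) (h : g ∈ (cellBoundary f).support) :
    IsFacet g f := by
  classical
  induction f generalizing g with
  | nil => simp [cellBoundary] at h
  | cons l f ih =>
    rw [cellBoundary] at h
    rcases Finset.mem_union.1 (Finsupp.support_add h) with h | h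
    · obtain ⟨u, hu, rfl⟩ := Finset.mem_image.1 (Finsupp.mapDomain_support h)
      rw [blockBoundary] at hu
      have hex : ∃ t ∈ deshuffles l, t.2.1 ≠ [] ∧ t.2.2 ≠ [] ∧ u = [t.2.1, t.2.2] := by
        revert hu
        generalize deshuffles l = L
        induction L with
        | nil => simp
        | cons t L ihL =>
          intro hu
          rw [List.filter_cons] at hu
          split_ifs at hu with ht
          · rw [List.map_cons, List.sum_cons] at hu
            rcases Finset.mem_union.1 (Finsupp.support_add hu) with hu | hu
            · have := Finset.mem_singleton.1 (Finsupp.support_single_subset hu)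
              simp at ht
              exact ⟨t, by simp, ht.1, ht.2, this⟩
            · obtain ⟨t', h1, h2⟩ := ihL hu
              exact ⟨t', by simp [h1], h2⟩
          · obtain ⟨t', h1, h2⟩ := ihL hu
            exact ⟨t', by simp [h1], h2⟩
      obtain ⟨⟨s, a, b⟩, h1, h2, h3, rfl⟩ := hex
      exact ⟨[], f, l, a, b, s, h1, h2, h3, rfl, rfl⟩
    · obtain ⟨u, hu, rfl⟩ :=
        Finset.mem_image.1 (Finsupp.mapDomain_support (Finsupp.support_smul h))
      obtain ⟨p, q, l', a, b, s, h1, h2, h3, rfl, rfl⟩ := ih u hu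
      exact ⟨l :: p, q, l', a, b, s, h1, h2, h3, rfl, rfl⟩

end Symbols

/-! ### Subcomplexes of `cel(A)`, their cellular chain complexes and homology -/

/-- A subcomplex of `cel(A)`: a set of symbols containing all facets of its members. -/
structure Subcomplex (A : Type) where
  cells : Set (List (List A))
  isSymbol : ∀ f ∈ cells, IsSymbol f
  facet_mem : ∀ f ∈ cells, ∀ g, IsFacet g f → g ∈ cells

section Chains

variable {A : Type} [Fintype A]

/-- The free abelian group on the `k`-dimensional cells of `X`. -/
def Subcomplex.chains (X : Subcomplex A) (k : ℤ) : Submodule ℤ (List (List A) →₀ ℤ) :=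
  Finsupp.supported ℤ ℤ {f | f ∈ X.cells ∧ cellDim f = k}

theorem Subcomplex.boundary_mem (X : Subcomplex A) {i j : ℤ} (h : j + 1 = i) :
    ∀ z ∈ X.chains i, boundary A z ∈ X.chains j := by
  intro z hz
  rw [boundary, Finsupp.linearCombination_apply]
  refine Submodule.sum_mem _ fun f hf => Submodule.smul_mem _ _ ?_
  obtain ⟨hfX, hfd⟩ := (Finsupp.mem_supported ℤ z).1 hz hf
  refine (Finsupp.mem_supported ℤ _).2 fun g hg => ?_
  have hgf := isFacet_of_mem_support f g hg
  refine ⟨X.facet_mem f hfX g hgf, ?_⟩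
  have := hgf.length
  simp only [cellDim] at hfd ⊢
  omega

/-- The integral cellular chain complex of `X`. -/
def Subcomplex.chainComplex (X : Subcomplex A) : ChainComplex (ModuleCat.{0} ℤ) ℤ where
  X k := ModuleCat.of ℤ (X.chains k)
  d i j := ModuleCat.ofHom
    (if h : j + 1 = i then (boundary A).restrict (X.boundary_mem h) else 0)
  shape i j h := by
    rw [dif_neg (by simpa using h)]; rfl
  d_comp_d' i j k hij hjk := by
    simp only [ComplexShape.down_Rel] at hij hjk
    rw [dif_pos hij, dif_pos hjk]
    refine ModuleCat.hom_ext (LinearMap.ext fun z => Subtype.ext ?_)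
    exact boundary_boundary _

/-- The chain map induced by an inclusion of subcomplexes. -/
def Subcomplex.inclusion (X Y : Subcomplex A) (h : X.cells ⊆ Y.cells) :
    X.chainComplex ⟶ Y.chainComplex where
  f k := ModuleCat.ofHom (Submodule.inclusion
    (Finsupp.supported_mono fun _ hf => ⟨h hf.1, hf.2⟩))
  comm' i j hij := by
    simp only [ComplexShape.down_Rel] at hij
    simp only [Subcomplex.chainComplex]
    rw [dif_pos hij, dif_pos hij]
    exact ModuleCat.hom_ext (LinearMap.ext fun z => Subtype.ext rfl)

end Chains

/-- The shift `K_{* - r}` of a chain complex. -/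
def shift (K : ChainComplex (ModuleCat.{0} ℤ) ℤ) (r : ℕ) : ChainComplex (ModuleCat.{0} ℤ) ℤ where
  X k := K.X (k - r)
  d i j := K.d (i - r) (j - r)
  shape i j h := K.shape _ _ (by simp only [ComplexShape.down_Rel] at h ⊢; omega)
  d_comp_d' _ _ _ _ _ := K.d_comp_d _ _ _

/-! ### The complexes `cel(A, w)` and `P(A, W, w)` -/

/-- `cel(A, w)`: all symbols in which every block has at most `w` elements. -/
def cel (A : Type) (w : ℕ) : Subcomplex A where
  cells := {f | IsSymbol f ∧ ∀ b ∈ f, b.length ≤ w}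
  isSymbol _ hf := hf.1
  facet_mem f hf g hg := ⟨hg.isSymbol hf.1, fun b hb => by
    obtain ⟨c, hc, hbc⟩ := hg.forall_sublist hb
    exact hbc.length_le.trans (hf.2 c hc)⟩

/-- `P(A, W, w)`, the complex of those faces of the permutohedron on `A` all of whose blocks have
total weight at most `w`. The cells of the permutohedron are the ordered set partitions of `A`; the
elements of each block are listed in increasing order. This is the embedding of the permutohedron
into `cel(A)` given by the order of `A`, and orients its cells. -/
def perm (A : Type) [LinearOrder A] (W : A → ℕ) (w : ℕ) : Subcomplex A where
  cells := {f | IsSymbol f ∧ (∀ b ∈ f, b.Pairwise (· < ·)) ∧ ∀ b ∈ f, (b.map W).sum ≤ w}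
  isSymbol _ hf := hf.1
  facet_mem f hf g hg := by
    refine ⟨hg.isSymbol hf.1, fun b hb => ?_, fun b hb => ?_⟩
    · obtain ⟨c, hc, hbc⟩ := hg.forall_sublist hb
      exact (hf.2.1 c hc).sublist hbc
    · obtain ⟨c, hc, hbc⟩ := hg.forall_sublist hb
      exact ((hbc.map W).sum_le_sum fun _ _ => Nat.zero_le _).trans (hf.2.2 c hc)

/-! ### Wheels and layers -/

/-- The decomposition of a word into wheels: a wheel starts at each entry (its axle) which is
larger than all the entries before it. -/
def wheels {A : Type} [LinearOrder A] : List A → List (List A)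
  | [] => []
  | a :: l => (a :: l.takeWhile fun x => decide (x < a)) ::
      wheels (l.dropWhile fun x => decide (x < a))
termination_by l => l.length
decreasing_by
  simp only [List.length_cons]
  exact Nat.lt_succ_of_le (List.length_dropWhile_le _ _)

/-- The one-line notation `σ(1) σ(2) ⋯ σ(n)` of a permutation. -/
def word {n : ℕ} (σ : Equiv.Perm (Fin n)) : List (Fin n) := List.ofFn σ

/-- The wheels of a permutation; they come in ascending order of their axles. -/
def wheelsOf {n : ℕ} (σ : Equiv.Perm (Fin n)) : List (List (Fin n)) := wheels (word σ)

/-- `#σ`, which is `n` minus the number of wheels of `σ`. -/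
def spinDim {n : ℕ} (σ : Equiv.Perm (Fin n)) : ℕ := n - (wheelsOf σ).length

theorem length_wheels_le {A : Type} [LinearOrder A] (l : List A) :
    (wheels l).length ≤ l.length := by
  induction l using wheels.induct with
  | case1 => simp [wheels]
  | case2 a l ih =>
    rw [wheels, List.length_cons, List.length_cons]
    exact Nat.succ_le_succ (ih.trans (List.length_dropWhile_le _ _))

/-- The permutohedron used for `σ` is on `n - #σ` points, namely the wheels of `σ`. -/
theorem length_wheelsOf {n : ℕ} (σ : Equiv.Perm (Fin n)) :
    (wheelsOf σ).length = n - spinDim σ := by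
  have h : (wheelsOf σ).length ≤ n := by
    simpa [wheelsOf, word] using length_wheels_le (word σ)
  simp only [spinDim]
  omega

/-- `P(n - #σ, W(σ), w)`: the points are the wheels of `σ` (numbered in ascending order of axles),
each weighted by its number of elements. -/
def wheelPerm {n : ℕ} (σ : Equiv.Perm (Fin n)) (w : ℕ) : Subcomplex (Fin (wheelsOf σ).length) :=
  perm (Fin (wheelsOf σ).length) (fun i => ((wheelsOf σ).get i).length) w

/-- The part of `cel(n, w)` lying in the union of the closed top-dimensional cells of `cel(n)`
indexed by the permutations in `S`: all symbols of which some permutation in `S` is a shuffle. -/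
def layers {n : ℕ} (S : Set (Equiv.Perm (Fin n))) (w : ℕ) : Subcomplex (Fin n) where
  cells := {f | f ∈ (cel (Fin n) w).cells ∧ ∃ τ ∈ S, ∀ b ∈ f, b.Sublist (word τ)}
  isSymbol _ hf := hf.1.1
  facet_mem f hf g hg := by
    obtain ⟨hf, τ, hτ, h⟩ := hf
    refine ⟨(cel (Fin n) w).facet_mem f hf g hg, τ, hτ, fun b hb => ?_⟩
    obtain ⟨c, hc, hbc⟩ := hg.forall_sublist hb
    exact hbc.trans (h c hc)

/-- `L(≤ σ)` in `cel(n, w)`, for the lexicographic order on permutations. -/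
def layerLE {n : ℕ} (σ : Equiv.Perm (Fin n)) (w : ℕ) : Subcomplex (Fin n) :=
  layers {τ | toLex (τ : Fin n → Fin n) ≤ toLex (σ : Fin n → Fin n)} w

/-- `L(< σ)` in `cel(n, w)`, for the lexicographic order on permutations. -/
def layerLT {n : ℕ} (σ : Equiv.Perm (Fin n)) (w : ℕ) : Subcomplex (Fin n) :=
  layers {τ | toLex (τ : Fin n → Fin n) < toLex (σ : Fin n → Fin n)} w

theorem layerLT_subset_layerLE {n : ℕ} (σ : Equiv.Perm (Fin n)) (w : ℕ) :
    (layerLT σ w).cells ⊆ (layerLE σ w).cells :=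
  fun _ ⟨h, τ, hτ, hs⟩ => ⟨h, τ, Set.mem_ofPred.2 (le_of_lt (Set.mem_ofPred.1 hτ)), hs⟩

theorem layerLE_subset_cel {n : ℕ} (σ : Equiv.Perm (Fin n)) (w : ℕ) :
    (layerLE σ w).cells ⊆ (cel (Fin n) w).cells :=
  fun _ h => h.1

/-! ### Spinning the wheels -/

/-- The orderings obtained by spinning a wheel, with signs. The wheel is passed in reverse order:
its last element `x` is placed either behind or in front of each ordering `u` of the spun wheel of
the remaining elements. The sign relative to `u x` of the term `x u` is the one, `(-1)^(|u| + 1)`,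
for which the common faces of the two top-dimensional cells cancel. -/
def spinRev {A : Type} : List A → List (ℤ × List A)
  | [] => [(1, [])]
  | [x] => [(1, [x])]
  | x :: y :: l => (spinRev (y :: l)).flatMap fun t =>
      [(t.1, t.2 ++ [x]), ((-1) ^ (t.2.length + 1) * t.1, x :: t.2)]

/-- All ways of spinning each of the wheels in one block, concatenated, with signs. -/
def spinBlock {A : Type} : List (List A) → List (ℤ × List A)
  | [] => [(1, [])]
  | v :: vs => (spinRev v.reverse).flatMap fun t =>
      (spinBlock vs).map fun u => (t.1 * u.1, t.2 ++ u.2)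

/-- All ways of spinning each of the wheels in each of the blocks, with signs. -/
def spinBlocks {A : Type} : List (List (List A)) → List (ℤ × List (List A))
  | [] => [(1, [])]
  | b :: bs => (spinBlock b).flatMap fun t =>
      (spinBlocks bs).map fun u => (t.1 * u.1, t.2 :: u.2)

/-- For a cell `c` of the permutohedron on the wheels of `σ`: the signed sum of the `2 ^ #σ` cells
of `cel(n)` obtained from `c` by replacing each wheel by its elements, in one of the orderings
produced by spinning the wheel. -/
def spinCell {n : ℕ} (σ : Equiv.Perm (Fin n)) (c : List (List (Fin (wheelsOf σ).length))) :
    List (List (Fin n)) →₀ ℤ :=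
  ((spinBlocks (c.map fun b => b.map (wheelsOf σ).get)).map fun t =>
    Finsupp.single t.2 t.1).sum

/-- A chain map `C_{* - #σ}(P(n - #σ, W(σ), w)) → C_*(L(≤ σ))` is a spinning map if, up to a sign
`ε c` that depends on the cell, it takes each cell `c` to the signed sum `spinCell σ c`. -/
def IsSpinningMap {n w : ℕ} (σ : Equiv.Perm (Fin n))
    (i : shift (wheelPerm σ w).chainComplex (spinDim σ) ⟶ (layerLE σ w).chainComplex) : Prop :=
  ∃ ε : List (List (Fin (wheelsOf σ).length)) → ℤˣ,
    ∀ (k : ℤ) (z : (wheelPerm σ w).chains (k - spinDim σ)),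
      ((i.f k).hom z : (layerLE σ w).chains k).1 =
        Finsupp.linearCombination ℤ (fun c => (ε c : ℤ) • spinCell σ c) z.1

end StripCell

end

open StripCell

/-! The splitting of the homology already exists on chains, for two reasons.

Algebra. Give every letter degree one. With the signs of spinning, placing `x` behind or in front of
`u` produces the graded commutator `u x - (-1)^|u| x u`. A spun wheel is thus an iterated graded
commutator of letters, hence primitive for the deshuffling coproduct that defines the boundary of a
block (`termSum_spinRev_deshuffleSum`). In the boundary of a spun cell all cuts through a wheel
cancel. What survives is the boundary in the permutohedron on the wheels, with Koszul signs in which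
a wheel has its length as degree instead of one. The sign `(-1) ^ spinExp` of a cell absorbs the
difference, so that spinning becomes a chain map (`boundary_spinChain`).

Order. The axle is the largest letter of its wheel, so every spinning other than the trivial one
makes the word lexicographically smaller. Modulo `L(< σ)`, spinning a cell therefore just inserts
the unspun wheels (`spinChain_sub_leadingTerm_mem`). The symbols obtained by this insertion are
exactly the symbols of `L(≤ σ)` that are not in `L(< σ)` (`exists_expand_eq`,
`expand_notMem_layerLT`). The spinning map is thus unitriangular up to signs, and the chains of `L(≤
σ)` are the direct sum of those of `L(< σ)` and the image of the spinning map. Running through the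
lexicographic order decomposes the chains of `cel(n, w)`. All of these are direct sums of complexes,
so they pass to homology. -/

namespace StripCell

/-! ### Signed sums over spinnings, and primitivity of a spun wheel -/

section SpinSums

variable {A B M N : Type} [AddCommGroup M] [AddCommGroup N]

/-- The sum of a function over the terms of a list of words with coefficients. -/
def termSum (L : List (ℤ × B)) (G : B → M) : M := (L.map fun t => t.1 • G t.2).sum

theorem termSum_add (L : List (ℤ × B)) (G H : B → M) :
    termSum L (fun u => G u + H u) = termSum L G + termSum L H := by
  simp [termSum, smul_add, List.sum_map_add]

theorem map_termSum (φ : M →ₗ[ℤ] N) (L : List (ℤ × B)) (G : B → M) :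
    φ (termSum L G) = termSum L (fun u => φ (G u)) := by
  unfold termSum
  rw [map_list_sum, List.map_map]
  congr 1
  exact List.map_congr_left fun t _ => by simp

theorem termSum_smul (c : ℤ) (L : List (ℤ × B)) (G : B → M) :
    termSum L (fun u => c • G u) = c • termSum L G :=
  (map_termSum (LinearMap.lsmul ℤ M c) L G).symm

theorem termSum_zero (L : List (ℤ × B)) : termSum L (fun _ => (0 : M)) = 0 := by
  simp [termSum]

theorem termSum_congr {L : List (ℤ × B)} {G H : B → M} (h : ∀ t ∈ L, G t.2 = H t.2) :
    termSum L G = termSum L H := by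
  unfold termSum
  congr 1
  exact List.map_congr_left fun t ht => by rw [h t ht]

theorem termSum_flatMap {C : Type} (L : List (ℤ × B)) (f : ℤ × B → List (ℤ × C)) (G : C → M)
    (H : B → M) (h : ∀ t ∈ L, termSum (f t) G = t.1 • H t.2) :
    termSum (L.flatMap f) G = termSum L H := by
  induction L with
  | nil => simp [termSum]
  | cons t L ih =>
    have ih' := ih fun t ht => h t (by simp [ht])
    have ht := h t (by simp)
    simp only [termSum] at ih' ht ⊢
    simp [ih', ht]

theorem termSum_comm {C : Type} (L : List (ℤ × B)) (L' : List (ℤ × C)) (G : B → C → M) :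
    termSum L (fun u => termSum L' (G u)) = termSum L' (fun v => termSum L fun u => G u v) := by
  induction L with
  | nil => simp [termSum]
  | cons t L ih =>
    have e : ∀ H : B → M, termSum (t :: L) H = t.1 • H t.2 + termSum L H := fun H => by
      simp [termSum]
    simp only [e, termSum_add, ih, termSum_smul]

theorem deshuffleSum_smul (c : ℤ) (l : List A) (F : List A → List A → M) :
    deshuffleSum l (fun a b => c • F a b) = c • deshuffleSum l F :=
  (smul_deshuffleSum c l F).symm

theorem perm_of_mem_spinRev {v : List A} {t : ℤ × List A} (h : t ∈ spinRev v) : t.2.Perm v := by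
  induction v using spinRev.induct generalizing t with
  | case1 => simp [spinRev] at h; simp [h]
  | case2 x => simp [spinRev] at h; simp [h]
  | case3 x y l ih =>
    simp only [spinRev, List.mem_flatMap, List.mem_cons, List.not_mem_nil, or_false] at h
    obtain ⟨s, hs, rfl | rfl⟩ := h
    · exact (List.perm_append_singleton x s.2).trans ((ih hs).cons x)
    · exact (ih hs).cons x

theorem termSum_spinRev_cons (x y : A) (l : List A) (G : List A → M) :
    termSum (spinRev (x :: y :: l)) G = termSum (spinRev (y :: l)) (fun u => G (u ++ [x])) +
      (-1 : ℤ) ^ (l.length + 2) • termSum (spinRev (y :: l)) (fun u => G (x :: u)) := by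
  rw [spinRev, ← termSum_smul, ← termSum_add]
  refine termSum_flatMap _ _ _ _ fun t ht => ?_
  have hl := (perm_of_mem_spinRev ht).length_eq
  simp [termSum, hl, smul_smul, mul_comm]

/-- A spun wheel is primitive for the coproduct given by deshuffling. -/
theorem termSum_spinRev_deshuffleSum (v : List A) (hv : v ≠ []) (l : List A)
    (F : List A → List A → M) :
    termSum (spinRev v) (fun u => deshuffleSum (u ++ l) F) =
      deshuffleSum l (fun a b => termSum (spinRev v) (fun u => F (u ++ a) b) +
        (-1 : ℤ) ^ (v.length * a.length) • termSum (spinRev v) (fun u => F a (u ++ b))) := by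
  induction v using spinRev.induct generalizing l F with
  | case1 => simp at hv
  | case2 x => simp [spinRev, termSum, deshuffleSum_cons, deshuffleSum_add]
  | case3 x y v ih =>
    have ih := ih (by simp)
    -- The recursion is a graded commutator with the letter `x`, and a graded commutator of
    -- primitives is primitive: the terms with `x` and the rest of the wheel on different sides
    -- cancel.
    simp only [termSum_spinRev_cons]
    simp only [List.append_assoc, List.cons_append, List.nil_append]
    rw [ih]
    have e : ∀ u : List A, deshuffleSum (x :: (u ++ l)) F = deshuffleSum (u ++ l)
        (fun a b => F (x :: a) b + (-1 : ℤ) ^ a.length • F a (x :: b)) := fun u => by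
      rw [deshuffleSum_cons, deshuffleSum_add]
    simp only [e]
    rw [ih, deshuffleSum_cons, ← deshuffleSum_add, ← deshuffleSum_smul, ← deshuffleSum_add]
    refine deshuffleSum_congr fun a b _ => ?_
    have e2 : termSum (spinRev (y :: v)) (fun u => F (x :: (u ++ a)) b +
        (-1 : ℤ) ^ (u ++ a).length • F (u ++ a) (x :: b)) =
        termSum (spinRev (y :: v)) (fun u => F (x :: (u ++ a)) b) +
        (-1 : ℤ) ^ (v.length + 1 + a.length) • termSum (spinRev (y :: v))
          (fun u => F (u ++ a) (x :: b)) := by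
      rw [← termSum_smul, ← termSum_add]
      refine termSum_congr fun t ht => ?_
      have hl := (perm_of_mem_spinRev ht).length_eq
      simp [hl]
    rw [e2]
    simp only [termSum_add, termSum_smul, List.length_cons]
    -- Only the parities of the two lengths enter the signs, so the cancellation is checked in four
    -- cases.
    rcases neg_one_pow_eq_or ℤ v.length with hp | hp <;>
    rcases neg_one_pow_eq_or ℤ a.length with ha | ha <;>
    simp only [add_mul, mul_add, pow_add, pow_mul, hp, ha, one_pow, pow_one, mul_one, one_mul] <;>
    module

theorem deshuffleSum_congr_mem {l : List A} {F G : List A → List A → M}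
    (h : ∀ a b, (a ++ b).Perm l → a.Sublist l → b.Sublist l → F a b = G a b) :
    deshuffleSum l F = deshuffleSum l G := by
  unfold deshuffleSum
  congr 1
  refine List.map_congr_left ?_
  rintro ⟨s, a, b⟩ ht
  rw [h a b (deshuffles_perm ht) (deshuffles_sublist ht).1 (deshuffles_sublist ht).2]

theorem termSum_spinBlock_cons (v : List A) (vs : List (List A)) (G : List A → M) :
    termSum (spinBlock (v :: vs)) G =
      termSum (spinRev v.reverse) fun t => termSum (spinBlock vs) fun u => G (t ++ u) := by
  rw [spinBlock]
  refine termSum_flatMap _ _ _ _ fun t _ => ?_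
  rw [← termSum_smul]
  simp only [termSum, List.map_map, Function.comp_def, mul_smul, smul_comm t.1]

theorem termSum_spinBlocks_cons (b : List (List A)) (bs : List (List (List A)))
    (G : List (List A) → M) :
    termSum (spinBlocks (b :: bs)) G =
      termSum (spinBlock b) fun l => termSum (spinBlocks bs) fun f => G (l :: f) := by
  rw [spinBlocks]
  refine termSum_flatMap _ _ _ _ fun t _ => ?_
  rw [← termSum_smul]
  simp only [termSum, List.map_map, Function.comp_def, mul_smul, smul_comm t.1]

theorem perm_of_mem_spinBlock {vs : List (List A)} {t : ℤ × List A} (h : t ∈ spinBlock vs) :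
    t.2.Perm vs.flatten := by
  induction vs generalizing t with
  | nil => simp [spinBlock] at h; simp [h]
  | cons v vs ih =>
    simp only [spinBlock, List.mem_flatMap, List.mem_map] at h
    obtain ⟨s, hs, u, hu, rfl⟩ := h
    exact ((perm_of_mem_spinRev hs).trans (List.reverse_perm v)).append (ih hu)

theorem length_of_mem_spinBlock (V : A → List B) {a : List A} {t : ℤ × List B}
    (h : t ∈ spinBlock (a.map V)) : t.2.length = (a.map fun i => (V i).length).sum := by
  rw [(perm_of_mem_spinBlock h).length_eq, List.length_flatten, List.map_map]
  rfl

theorem neg_one_pow_congr {m k : ℕ} (h : m % 2 = k % 2) : (-1 : ℤ) ^ m = (-1) ^ k := by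
  rw [neg_one_pow_eq_pow_mod_two, h, ← neg_one_pow_eq_pow_mod_two]

/-- The signed sum of the symbols obtained from `c` by spinning the words `V i`. -/
noncomputable def spinSum (V : A → List B) (c : List (List A)) : List (List B) →₀ ℤ :=
  termSum (spinBlocks (c.map fun b => b.map V)) fun f => Finsupp.single f 1

/-- Put the block `b`, with its words `V i` spun, in front of a formal sum of symbols. -/
noncomputable def spinBlockMul (V : A → List B) (b : List A) :
    (List (List B) →₀ ℤ) →ₗ[ℤ] (List (List B) →₀ ℤ) :=
  ((spinBlock (b.map V)).map fun t => t.1 • Finsupp.lmapDomain ℤ ℤ (fun f => t.2 :: f)).sum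

theorem spinBlockMul_apply (V : A → List B) (b : List A) (x : List (List B) →₀ ℤ) :
    spinBlockMul V b x = termSum (spinBlock (b.map V)) fun l => x.mapDomain fun f => l :: f := by
  unfold spinBlockMul termSum
  induction spinBlock (b.map V) with
  | nil => simp
  | cons t L ih =>
    rw [List.map_cons, List.sum_cons, LinearMap.add_apply, ih, List.map_cons, List.sum_cons]
    rfl

theorem spinSum_cons (V : A → List B) (b : List A) (c : List (List A)) :
    spinSum V (b :: c) = spinBlockMul V b (spinSum V c) := by
  rw [spinBlockMul_apply, spinSum, List.map_cons, termSum_spinBlocks_cons]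
  refine termSum_congr fun t _ => ?_
  have := map_termSum (Finsupp.lmapDomain ℤ ℤ fun f => t.2 :: f)
    (spinBlocks (c.map fun b => b.map V)) (fun f => Finsupp.single f (1 : ℤ))
  simp only [Finsupp.lmapDomain_apply, Finsupp.mapDomain_single] at this
  exact this.symm

end SpinSums

/-! ### Koszul signs; spinning commutes with the boundary -/

section Signs

variable {A B M : Type} [LinearOrder A] [AddCommGroup M]

/-- The sum of `W i * W j + 1` over the pairs of labels `i < j` such that `j` occurs in `a` and
`i` in `b`. -/
def inversionExp (W : A → ℕ) (a b : List A) : ℕ :=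
  (a.map fun j => (b.map fun i => if i < j then W i * W j + 1 else 0).sum).sum

theorem inversionExp_append_left (W : A → ℕ) (a a' b : List A) :
    inversionExp W (a ++ a') b = inversionExp W a b + inversionExp W a' b := by
  simp [inversionExp]

theorem inversionExp_append_right (W : A → ℕ) (a b b' : List A) :
    inversionExp W a (b ++ b') = inversionExp W a b + inversionExp W a b' := by
  simp [inversionExp, List.sum_map_add]

theorem inversionExp_perm_left (W : A → ℕ) {a a' : List A} (h : a.Perm a') (b : List A) :
    inversionExp W a b = inversionExp W a' b :=
  (h.map _).sum_eq

theorem inversionExp_perm_right (W : A → ℕ) (a : List A) {b b' : List A} (h : b.Perm b') :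
    inversionExp W a b = inversionExp W a b' := by
  unfold inversionExp
  congr 1
  exact List.map_congr_left fun j _ => (h.map _).sum_eq

theorem inversionExp_cons_left (W : A → ℕ) {i : A} (a : List A) {b : List A}
    (h : ∀ j ∈ b, i < j) : inversionExp W (i :: a) b = inversionExp W a b := by
  simp only [inversionExp, List.map_cons, List.sum_cons, Nat.add_eq_right, List.sum_eq_zero_iff,
    List.mem_map]
  rintro _ ⟨j, hj, rfl⟩
  exact if_neg (h j hj).not_gt

theorem inversionExp_cons_right (W : A → ℕ) {i : A} {a : List A} (b : List A)
    (h : ∀ j ∈ a, i < j) :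
    inversionExp W a (i :: b) = inversionExp W a b + (W i * (a.map W).sum + a.length) := by
  induction a with
  | nil => simp [inversionExp]
  | cons j a ih =>
    have ih := ih fun j hj => h j (by simp [hj])
    simp only [inversionExp, List.map_cons, List.sum_cons, List.length_cons] at ih ⊢
    rw [ih, if_pos (h j (by simp))]
    ring

/-- By primitivity each wheel goes as a whole to one side. Exchanging the wheels `i` and `j` costs
`(-1) ^ (W i * W j)`, while the deshuffle of the labels already counts `-1`; `inversionExp` is the
correction. -/
theorem termSum_spinBlock_deshuffleSum (V : A → List B) (hV : ∀ i, V i ≠ []) {b : List A}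
    (hb : b.Pairwise (· < ·)) (F : List B → List B → M) :
    termSum (spinBlock (b.map V)) (fun l => deshuffleSum l F) =
      deshuffleSum b fun a a' => (-1 : ℤ) ^ inversionExp (fun i => (V i).length) a a' •
        termSum (spinBlock (a.map V)) fun s => termSum (spinBlock (a'.map V)) fun t => F s t := by
  induction b generalizing F with
  | nil => simp [spinBlock, termSum, deshuffleSum, deshuffles, inversionExp]
  | cons i b ih =>
    rw [List.map_cons, termSum_spinBlock_cons, termSum_comm]
    simp only [termSum_spinRev_deshuffleSum _ (List.reverse_eq_nil_iff.not.2 (hV i))]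
    rw [ih hb.of_cons, deshuffleSum_cons, ← deshuffleSum_add]
    refine deshuffleSum_congr_mem fun a a' _ ha ha' => ?_
    have hi : ∀ j ∈ b, i < j := fun j hj => List.rel_of_pairwise_cons hb hj
    rw [inversionExp_cons_left _ _ fun j hj => hi j (ha'.mem hj),
      inversionExp_cons_right _ _ fun j hj => hi j (ha.mem hj)]
    have e : ∀ s : ℤ × List B, s ∈ spinBlock (a.map V) →
        (termSum (spinBlock (a'.map V)) fun t => termSum (spinRev (V i).reverse)
          (fun u => F (u ++ s.2) t) + (-1 : ℤ) ^ ((V i).reverse.length * s.2.length) •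
          termSum (spinRev (V i).reverse) (fun u => F s.2 (u ++ t))) =
        termSum (spinRev (V i).reverse) (fun u => termSum (spinBlock (a'.map V)) fun t =>
          F (u ++ s.2) t) +
        (-1 : ℤ) ^ ((V i).length * (a.map fun i => (V i).length).sum) •
          termSum (spinBlock ((i :: a').map V)) fun t => F s.2 t := by
      intro s hs
      rw [length_of_mem_spinBlock V hs, termSum_add, termSum_smul, termSum_comm,
        List.length_reverse, List.map_cons, termSum_spinBlock_cons, termSum_comm (spinBlock _)]
    rw [termSum_congr (H := fun s => termSum (spinRev (V i).reverse)
        (fun u => termSum (spinBlock (a'.map V)) fun t => F (u ++ s) t) +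
        (-1 : ℤ) ^ ((V i).length * (a.map fun i => (V i).length).sum) •
          termSum (spinBlock ((i :: a').map V)) fun t => F s t) e, termSum_add, termSum_smul, smul_add,
      List.map_cons (l := a), termSum_spinBlock_cons,
      termSum_comm (spinRev _) (spinBlock (a.map V))]
    congr 1
    rw [smul_smul, smul_smul]
    congr 1
    -- `a.length` occurs twice, once from deshuffling the label `i` past `a` and once from the
    -- summands `+ 1` of `inversionExp`.
    rw [← pow_add, ← pow_add, add_comm a.length, ← add_assoc, add_assoc _ a.length, ← two_mul,
      pow_add _ _ (2 * _), pow_mul _ 2]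
    simp

/-- The exponent of the sign of a cell in the spinning map. -/
def spinExp (W : A → ℕ) : List (List A) → ℕ
  | [] => 0
  | b :: f => spinExp W f + (b.map fun i => W i + 1).sum * f.length + inversionExp W b f.flatten

/-- The linear extension of `spinSum`, with the signs that make it commute with the boundary. -/
noncomputable def spinChain (V : A → List B) : (List (List A) →₀ ℤ) →ₗ[ℤ] (List (List B) →₀ ℤ) :=
  Finsupp.linearCombination ℤ fun c =>
    (-1 : ℤ) ^ spinExp (fun i => (V i).length) c • spinSum V c

/-- All facets of `c` have one block more than `c` and the same labels, so the sign due to the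
leading block `b` is common to all terms. -/
theorem spinChain_mapDomain_cons (V : A → List B) (b : List A) {c : List (List A)}
    {x : List (List A) →₀ ℤ} (hx : ∀ g ∈ x.support, IsFacet g c) :
    spinChain V (x.mapDomain fun u => b :: u) =
      (-1 : ℤ) ^ ((b.map fun i => (V i).length + 1).sum * (c.length + 1) +
        inversionExp (fun i => (V i).length) b c.flatten) • spinBlockMul V b (spinChain V x) := by
  rw [Finsupp.mapDomain, Finsupp.sum, map_sum, spinChain,
    Finsupp.linearCombination_apply (v := _) (l := x), Finsupp.sum, map_sum, Finset.smul_sum]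
  refine Finset.sum_congr rfl fun g hg => ?_
  obtain hf := hx g hg
  have hp : g.flatten.Perm c.flatten := by
    obtain ⟨p, q, l, a, b, s, hs, -, -, rfl, rfl⟩ := hf
    simp only [List.flatten_append, List.flatten_cons]
    rw [← List.append_assoc a]
    exact List.Perm.append_left _ ((deshuffles_perm hs).append_right _)
  rw [Finsupp.linearCombination_single, map_smul, map_smul, spinSum_cons, spinExp, hf.length,
    inversionExp_perm_right _ _ hp, smul_comm _ (x g), smul_smul ((-1 : ℤ) ^ _),
    ← pow_add]
  congr 3
  ring

/-- The Leibniz rule, in which primitivity leaves only those cuts of the first block that distribute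
whole wheels. -/
theorem boundary_spinBlockMul (V : A → List B) (hV : ∀ i, V i ≠ []) {b : List A}
    (hb : b.Pairwise (· < ·)) (x : List (List B) →₀ ℤ) :
    boundary B (spinBlockMul V b x) =
      (deshuffleSum b fun a a' => if a = [] ∨ a' = [] then 0 else
        (-1 : ℤ) ^ (inversionExp (fun i => (V i).length) a a' +
          (a.map fun i => (V i).length).sum) • spinBlockMul V a (spinBlockMul V a' x)) +
      (-1 : ℤ) ^ ((b.map fun i => (V i).length).sum + 1) • spinBlockMul V b (boundary B x) := by
  classical
  -- Wheels are nonempty, so a cut of the spun block is proper exactly if the cut of the labels is.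
  have hn : ∀ (a : List A) (t : ℤ × List B), t ∈ spinBlock (a.map V) → (t.2 = [] ↔ a = []) := by
    intro a t ht
    rw [← List.length_eq_zero_iff, length_of_mem_spinBlock V ht]
    cases a with
    | nil => simp
    | cons i a => simp [hV i]
  rw [spinBlockMul_apply, map_termSum]
  simp only [boundary_cons, termSum_add, blockBoundaryMul_eq]
  congr 1
  · rw [termSum_spinBlock_deshuffleSum V hV hb]
    refine deshuffleSum_congr fun a a' _ => ?_
    split_ifs with h
    · convert smul_zero _ using 2
      refine (termSum_congr (H := fun _ => 0) fun s hs => ?_).trans (termSum_zero _)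
      refine (termSum_congr (H := fun _ => 0) fun t ht => ?_).trans (termSum_zero _)
      rw [if_pos (by rwa [hn a s hs, hn a' t ht])]
    · rw [pow_add, mul_smul]
      congr 1
      rw [spinBlockMul_apply, ← termSum_smul]
      refine termSum_congr fun s hs => ?_
      rw [spinBlockMul_apply, ← Finsupp.lmapDomain_apply ℤ ℤ, map_termSum, ← termSum_smul]
      refine termSum_congr fun t ht => ?_
      rw [if_neg (by rwa [hn a s hs, hn a' t ht]), length_of_mem_spinBlock V hs, Finsupp.lmapDomain_apply,
        ← Finsupp.mapDomain_comp]
      rfl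
  · rw [spinBlockMul_apply, ← termSum_smul]
    exact termSum_congr fun s hs => by rw [length_of_mem_spinBlock V hs]

/-- This is where the form of `spinExp` comes from. Cutting `b` into `a | a'` changes it by
`inversionExp W a a'` plus the sum of `W i + 1` over `a`, which turns `(-1) ^ |a|` into the sign for
the weight of `a`. Cutting a later block changes it by the sum of `W i + 1` over `b`, which does the
same for the Leibniz sign of `b`. -/
theorem boundary_spinChain_single (V : A → List B) (hV : ∀ i, V i ≠ []) {c : List (List A)}
    (hc : ∀ b ∈ c, b.Pairwise (· < ·)) :
    boundary B (spinChain V (Finsupp.single c 1)) = spinChain V (cellBoundary c) := by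
  classical
  induction c with
  | nil => simp [spinChain, cellBoundary, spinSum, spinBlocks, termSum]
  | cons b c ih =>
    have ih := ih fun b hb => hc b (by simp [hb])
    have hb := hc b (by simp)
    rw [spinChain, Finsupp.linearCombination_single, one_smul, map_smul, ← spinChain] at ih ⊢
    rw [spinSum_cons, boundary_spinBlockMul V hV hb, smul_add, cellBoundary, map_add, map_smul,
      spinChain_mapDomain_cons V b fun g hg => isFacet_of_mem_support c g hg, ← ih]
    congr 1
    · have e := map_blockBoundary (spinChain V ∘ₗ Finsupp.lmapDomain ℤ ℤ (fun v => v ++ c)) b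
      simp only [LinearMap.comp_apply, Finsupp.lmapDomain_apply, Finsupp.mapDomain_single,
        List.cons_append, List.nil_append] at e
      rw [e, ← deshuffleSum_smul]
      refine deshuffleSum_congr_mem fun a a' hp _ _ => ?_
      split_ifs
      · simp
      · rw [spinChain, Finsupp.linearCombination_single, one_smul, spinSum_cons, spinSum_cons,
          smul_smul, smul_smul]
        congr 1
        rw [← pow_add, ← pow_add]
        simp only [spinExp, List.flatten_cons, List.length_cons, inversionExp_append_right,
          ← inversionExp_perm_left _ hp, inversionExp_append_left, ← (hp.map _).sum_eq,
          List.map_append, List.sum_append, List.sum_map_add]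
        simp only [List.map_const', List.sum_replicate, smul_eq_mul, mul_one]
        refine neg_one_pow_congr ?_
        ring_nf
        omega
    · rw [map_smul, smul_smul, smul_smul, smul_smul, spinExp]
      congr 1
      rw [← pow_add, ← pow_add, ← pow_add]
      refine neg_one_pow_congr ?_
      simp only [List.sum_map_add, List.map_const', List.sum_replicate, smul_eq_mul, mul_one]
      ring_nf
      omega

theorem boundary_spinChain (V : A → List B) (hV : ∀ i, V i ≠ []) {x : List (List A) →₀ ℤ}
    (hx : ∀ c ∈ x.support, ∀ b ∈ c, b.Pairwise (· < ·)) :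
    boundary B (spinChain V x) = spinChain V (boundary A x) := by
  have e : x = ∑ c ∈ x.support, x c • Finsupp.single c 1 := by
    conv_lhs => rw [← Finsupp.sum_single x]
    simp [Finsupp.sum]
  rw [e]
  simp only [map_sum, map_smul]
  refine Finset.sum_congr rfl fun c hc => ?_
  rw [boundary_spinChain_single V hV (hx c hc), boundary_single, one_smul]

end Signs
-- Words, lexicographic order and wheels
section Lists

variable {A : Type}

theorem eq_filter_of_sublist [DecidableEq A] {c l : List A} (h : c.Sublist l) (hl : l.Nodup) :
    c = l.filter (· ∈ c) := by
  refine (hl.perm_iff_eq_of_sublist h List.filter_sublist).1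
    ((List.perm_ext_iff_of_nodup (hl.sublist h) (hl.filter _)).2 fun x => ?_)
  simp only [List.mem_filter, decide_eq_true_eq]
  exact ⟨fun hx => ⟨h.mem hx, hx⟩, fun hx => hx.2⟩

theorem eq_of_mem_of_nodup_flatten {f : List (List A)} (hf : f.flatten.Nodup) {b c : List A}
    (hb : b ∈ f) (hc : c ∈ f) {x : A} (hxb : x ∈ b) (hxc : x ∈ c) : b = c := by
  by_contra h
  have : Std.Symm (List.Disjoint (α := A)) := ⟨fun _ _ h => h.symm⟩
  exact (List.nodup_flatten.1 hf).2.forall hb hc h hxb hxc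

theorem exists_first_not {p : A → Prop} {l : List A} (h : ¬ ∀ x ∈ l, p x) :
    ∃ l₁ x l₂, l = l₁ ++ x :: l₂ ∧ (∀ y ∈ l₁, p y) ∧ ¬ p x := by
  induction l with
  | nil => simp at h
  | cons a l ih =>
    by_cases ha : p a
    · obtain ⟨l₁, x, l₂, rfl, h1, h2⟩ := ih fun hl => h (by simpa [ha] using hl)
      exact ⟨a :: l₁, x, l₂, rfl, by simpa [ha] using h1, h2⟩
    · exact ⟨[], a, l, rfl, by simp, ha⟩

variable [LinearOrder A]

theorem exists_of_lt_of_length_eq {u v : List A} (h : u < v) (hl : u.length = v.length) :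
    ∃ p x y r s, u = p ++ x :: r ∧ v = p ++ y :: s ∧ x < y := by
  induction u generalizing v with
  | nil =>
    obtain rfl := List.length_eq_zero_iff.1 hl.symm
    simp at h
  | cons a u ih =>
    obtain _ | ⟨b, v⟩ := v
    · simp at hl
    rcases List.cons_lt_cons_iff.1 h with hab | ⟨rfl, h'⟩
    · exact ⟨[], a, b, u, v, rfl, rfl, hab⟩
    · obtain ⟨p, x, y, r, s, rfl, rfl, hxy⟩ := ih h' (by simpa using hl)
      exact ⟨a :: p, x, y, r, s, rfl, rfl, hxy⟩

theorem append_lt_append_of_length_eq {u v : List A} (h : u < v) (hl : u.length = v.length)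
    (r s : List A) : u ++ r < v ++ s := by
  obtain ⟨p, x, y, r', s', rfl, rfl, hxy⟩ := exists_of_lt_of_length_eq h hl
  rw [List.append_assoc, List.append_assoc]
  exact List.append_left_lt (List.cons_lt_cons_iff.2 (Or.inl hxy))

theorem ofFn_lt_ofFn_iff {n : ℕ} (f g : Fin n → A) :
    List.ofFn f < List.ofFn g ↔ toLex f < toLex g := by
  rw [List.lt_iff_exists]
  constructor
  · rintro (⟨-, h⟩ | ⟨i, h₁, h₂, h, hi⟩)
    · simp at h
    · have hn : i < n := by simpa using h₁
      refine ⟨⟨i, hn⟩, fun j hj => ?_, by simpa using hi⟩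
      simpa using h j hj
  · rintro ⟨i, h, hi⟩
    refine Or.inr ⟨i, by simp, by simp, fun j hj => ?_, by simpa using hi⟩
    simpa using h ⟨j, hj.trans i.2⟩ hj

/-! ### The wheels of a word -/

theorem flatten_wheels (l : List A) : (wheels l).flatten = l := by
  induction l using wheels.induct with
  | case1 => simp [wheels]
  | case2 a l ih => rw [wheels, List.flatten_cons, ih, List.cons_append, List.takeWhile_append_dropWhile]

theorem exists_axle {l v : List A} (hv : v ∈ wheels l) :
    ∃ a t, v = a :: t ∧ ∀ x ∈ t, x < a := by
  induction l using wheels.induct with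
  | case1 => simp [wheels] at hv
  | case2 a l ih =>
    rw [wheels, List.mem_cons] at hv
    rcases hv with rfl | hv
    · exact ⟨a, _, rfl, fun x hx => by simpa using List.mem_takeWhile_imp hx⟩
    · exact ih hv

theorem le_axle (l : List A) :
    (wheels l).Pairwise fun v v' => ∀ y ∈ v, ∀ a ∈ v'.head?, y ≤ a := by
  induction l using wheels.induct with
  | case1 => simp [wheels]
  | case2 a l ih =>
    rw [wheels, List.pairwise_cons]
    refine ⟨fun v' hv' => ?_, ih⟩
    -- The axle `a` bounds its own wheel, so only axles need comparing; `dropWhile` stops at an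
    -- entry that is not below `a`.
    suffices h : ∀ b ∈ v'.head?, a ≤ b by
      intro y hy b hb
      refine le_trans ?_ (h b hb)
      rcases List.mem_cons.1 hy with rfl | hy
      · exact le_rfl
      · exact le_of_lt (by simpa using List.mem_takeWhile_imp hy)
    have hd := List.head?_dropWhile_not (fun x => decide (x < a)) l
    rcases hl : l.dropWhile (fun x => decide (x < a)) with _ | ⟨b, r⟩
    · simp [hl, wheels] at hv'
    · rw [hl] at ih hv' hd
      have hab : a ≤ b := by simpa using hd
      rw [wheels, List.pairwise_cons] at ih
      rw [wheels, List.mem_cons] at hv'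
      intro c hc
      rcases hv' with rfl | hv'
      · simp at hc; rwa [← hc]
      · exact hab.trans (ih.1 v' hv' b (by simp) c hc)

/-- The predecessor of an entry which is not a record lies in the same wheel. -/
theorem exists_pair_sublist_wheel {l p r₁ r₂ : List A} {x y : A} (hl : l.Nodup)
    (h : l = p ++ y :: (r₁ ++ x :: r₂)) (hxy : x < y) :
    ∃ v ∈ wheels l, ∃ z ∈ y :: r₁, [z, x].Sublist v := by
  obtain ⟨v, hv, hxv⟩ := List.exists_of_mem_flatten (L := wheels l) (a := x)
    (by rw [flatten_wheels, h]; simp)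
  refine ⟨v, hv, ?_⟩
  obtain ⟨ws₁, ws₂, hws⟩ := List.append_of_mem hv
  obtain ⟨s, t, rfl⟩ := List.append_of_mem hxv
  have e : l = (ws₁.flatten ++ s) ++ x :: (t ++ ws₂.flatten) := by
    conv_lhs => rw [← flatten_wheels l, hws]
    simp
  have h' : l = (p ++ y :: r₁) ++ x :: r₂ := by rw [h]; simp
  have hn : ∀ {q q' : List A}, l = q ++ x :: q' → x ∉ q := by
    intro q q' hq hx
    rw [hq] at hl
    exact (List.nodup_append.1 hl).2.2 x hx x (by simp) rfl
  have hn' : ∀ {q q' : List A}, l = q ++ x :: q' → x ∉ q' := by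
    intro q q' hq hx
    rw [hq] at hl
    exact (List.nodup_cons.1 (List.nodup_append.1 hl).2.1).1 hx
  have hs : ws₁.flatten ++ s = p ++ y :: r₁ :=
    ((List.append_cons_inj_of_notMem (hn h') (hn' h')).1 (h'.symm.trans e)).1.symm
  -- Here `s` is the part of the wheel before `x`. If it were empty, `x` would be an axle and `y`,
  -- lying in an earlier wheel, could not exceed it. Otherwise the last letter of `s` is the
  -- predecessor of `x`.
  rcases List.eq_nil_or_concat' s with rfl | ⟨s, z, rfl⟩
  · exfalso
    have hy : y ∈ ws₁.flatten := by rw [List.append_nil] at hs; rw [hs]; simp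
    obtain ⟨u, hu, hyu⟩ := List.exists_of_mem_flatten hy
    have := le_axle l
    rw [hws, List.pairwise_append] at this
    exact (this.2.2 u hu ([] ++ x :: t) (by simp) y hyu x (by simp)).not_gt hxy
  · refine ⟨z, ?_, ?_⟩
    · have := congrArg List.getLast? hs
      simp only [List.getLast?_append] at this
      rw [List.getLast?_eq_some_getLast (List.cons_ne_nil y r₁), List.getLast?_singleton,
        Option.some_or, Option.some_or] at this
      rw [Option.some.inj this]
      exact List.getLast_mem _
    · rw [List.append_assoc]
      exact ((List.nil_sublist t).cons_cons x |>.cons_cons z).trans (List.sublist_append_right s _)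

end Lists

/-! ### Inserting words for labels; the leading term of a spun cell -/

section Expand

variable {A B M : Type} [AddCommGroup M]

/-- Replace each label `i` of a symbol by the word `U i`. -/
def expand (U : A → List B) (c : List (List A)) : List (List B) := c.map fun b => b.flatMap U

theorem flatten_expand (U : A → List B) (c : List (List A)) :
    (expand U c).flatten = c.flatten.flatMap U := by
  induction c with
  | nil => rfl
  | cons b c ih => simp [expand] at ih ⊢; rw [ih]

/-- A block is decoded from the left: its first letter determines the first label, whose word is
then cancelled. -/
theorem expand_injective {U : A → List B} (hU : ∀ i, U i ≠ [])
    (hh : ∀ i j, (U i).head? = (U j).head? → i = j) : Function.Injective (expand U) := by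
  refine List.map_injective_iff.2 fun b b' h => ?_
  induction b generalizing b' with
  | nil =>
    rcases b' with _ | ⟨j, b'⟩
    · rfl
    · have := hU j
      simp_all
  | cons i b ih =>
    rcases b' with _ | ⟨j, b'⟩
    · have := hU i
      simp_all
    · simp only [List.flatMap_cons] at h
      have hij : i = j := by
        refine hh i j ?_
        have e := congrArg List.head? h
        rw [List.head?_append, List.head?_append] at e
        rcases hi : U i with _ | ⟨x, r⟩
        · exact absurd hi (hU i)
        rcases hj : U j with _ | ⟨y, s⟩
        · exact absurd hj (hU j)
        simpa [hi, hj] using e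
      subst hij
      rw [ih _ (List.append_cancel_left h)]

theorem termSum_mem {C : Type} (N : Submodule ℤ M) {L : List (ℤ × C)} {G : C → M}
    (h : ∀ t ∈ L, G t.2 ∈ N) : termSum L G ∈ N := by
  refine list_sum_mem fun x hx => ?_
  obtain ⟨t, ht, rfl⟩ := List.mem_map.1 hx
  exact N.smul_mem _ (h t ht)

variable [LinearOrder B]

/-- `u` is `v`, or a lexicographically smaller rearrangement of `v`. -/
def IsSpun (u v : List B) : Prop := u = v ∨ (u.Perm v ∧ u < v)

theorem IsSpun.perm {u v : List B} (h : IsSpun u v) : u.Perm v := by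
  rcases h with rfl | h
  · exact List.Perm.refl _
  · exact h.1

/-- The first label with `U i ≠ V i` decides, because the two words for it have equal length. -/
theorem flatMap_lt_flatMap {U V : A → List B} (hU : ∀ i, IsSpun (U i) (V i)) {L : List A}
    (hL : ∃ i ∈ L, U i ≠ V i) : L.flatMap U < L.flatMap V := by
  induction L with
  | nil => simp at hL
  | cons i L ih =>
    rw [List.flatMap_cons, List.flatMap_cons]
    rcases hU i with h | ⟨hp, hlt⟩
    · rw [h]
      refine List.append_left_lt (ih ?_)
      obtain ⟨j, hj, hne⟩ := hL
      rcases List.mem_cons.1 hj with rfl | hj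
      · exact absurd h hne
      · exact ⟨j, hj, hne⟩
    · exact append_lt_append_of_length_eq hlt hp.length_eq _ _

/-- A front placement puts a letter below `a` first, where the unspun wheel has `a`, so it lowers
the word. Only the spinning with all placements at the end survives modulo `N`, which in the
application is the chain group of `L(< σ)`. -/
theorem termSum_spinRev_sub_mem (N : Submodule ℤ M) (a : B) (t : List B) (ht : ∀ x ∈ t, x < a)
    (G : List B → M) (hG : ∀ u, u.Perm (a :: t) → u < a :: t → G u ∈ N) :
    termSum (spinRev (a :: t).reverse) G - G (a :: t) ∈ N := by
  induction t using List.reverseRecOn generalizing G with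
  | nil => simp [spinRev, termSum]
  | append_singleton t x ih =>
    have e : (a :: (t ++ [x])).reverse = x :: (a :: t).reverse := by simp
    rw [e]
    rcases hr : (a :: t).reverse with _ | ⟨y, l⟩
    · simp at hr
    rw [termSum_spinRev_cons, ← hr, add_sub_right_comm]
    refine N.add_mem (ih (fun z hz => ht z (by simp [hz])) (fun u => G (u ++ [x])) ?_)
      (N.smul_mem _ (termSum_mem N fun s hs => ?_))
    · intro u hp hlt
      refine hG _ (hp.append_right [x]) ?_
      exact append_lt_append_of_length_eq hlt hp.length_eq [x] [x]
    · have hp : s.2.Perm (a :: t) := (perm_of_mem_spinRev hs).trans (List.reverse_perm _)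
      refine hG _ ((hp.cons x).trans ?_) (List.cons_lt_cons_iff.2 (Or.inl (ht x (by simp))))
      exact ((List.perm_append_singleton x (a :: t)).symm)

variable [DecidableEq A]

theorem termSum_spinBlock_sub_mem (N : Submodule ℤ M) (V : A → List B)
    (hV : ∀ i, ∃ a t, V i = a :: t ∧ ∀ x ∈ t, x < a) {b : List A} (hb : b.Nodup)
    (G : List B → M)
    (hG : ∀ U : A → List B, (∀ i, IsSpun (U i) (V i)) → (∃ i ∈ b, U i ≠ V i) →
      G (b.flatMap U) ∈ N) :
    termSum (spinBlock (b.map V)) G - G (b.flatMap V) ∈ N := by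
  induction b generalizing G with
  | nil => simp [spinBlock, termSum]
  | cons i b ih =>
    have hi : i ∉ b := (List.nodup_cons.1 hb).1
    have key : ∀ u, IsSpun u (V i) → ∀ U : A → List B, (∀ j, IsSpun (U j) (V j)) →
        (u ≠ V i ∨ ∃ j ∈ b, U j ≠ V j) → G (u ++ b.flatMap U) ∈ N := by
      intro u hu U hU hne
      -- The label `i` does not recur in `b`, so its spinning can be prescribed independently of the
      -- others.
      have e : b.flatMap (Function.update U i u) = b.flatMap U :=
        List.flatMap_congr fun j hj => Function.update_of_ne (by rintro rfl; exact hi hj) _ _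
      have := hG (Function.update U i u) (fun j => ?_) ?_
      · rwa [List.flatMap_cons, Function.update_self, e] at this
      · by_cases hj : j = i
        · subst hj; simpa using hu
        · simpa [hj] using hU j
      · rcases hne with hne | ⟨j, hj, hne⟩
        · exact ⟨i, by simp, by simpa using hne⟩
        · exact ⟨j, by simp [hj], by
            rwa [Function.update_of_ne (by rintro rfl; exact hi hj)]⟩
    have hb' : ∀ u, IsSpun u (V i) →
        termSum (spinBlock (b.map V)) (fun s => G (u ++ s)) - G (u ++ b.flatMap V) ∈ N :=
      fun u hu => ih hb.of_cons (fun s => G (u ++ s)) fun U hU hne => key u hu U hU (Or.inr hne)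
    obtain ⟨a, t, hat, hlt⟩ := hV i
    have h1 := termSum_spinRev_sub_mem N a t hlt
      (fun u => termSum (spinBlock (b.map V)) fun s => G (u ++ s)) fun u hp hlt => by
        have hu : IsSpun u (V i) := Or.inr (by rw [hat]; exact ⟨hp, hlt⟩)
        have := N.add_mem (hb' u hu) (key u hu V (fun j => Or.inl rfl) (Or.inl (by
          rw [hat]; exact hlt.ne)))
        rwa [sub_add_cancel] at this
    rw [List.map_cons, termSum_spinBlock_cons, List.flatMap_cons]
    rw [← hat] at h1
    have := N.add_mem h1 (hb' (V i) (Or.inl rfl))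
    rwa [sub_add_sub_cancel] at this

theorem termSum_spinBlocks_sub_mem (N : Submodule ℤ M) (V : A → List B)
    (hV : ∀ i, ∃ a t, V i = a :: t ∧ ∀ x ∈ t, x < a) {c : List (List A)} (hc : c.flatten.Nodup)
    (G : List (List B) → M)
    (hG : ∀ U : A → List B, (∀ i, IsSpun (U i) (V i)) → (∃ i ∈ c.flatten, U i ≠ V i) →
      G (expand U c) ∈ N) :
    termSum (spinBlocks (c.map fun b => b.map V)) G - G (expand V c) ∈ N := by
  induction c generalizing G with
  | nil => simp [spinBlocks, termSum, expand]
  | cons b c ih =>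
    rw [List.flatten_cons, List.nodup_append] at hc
    obtain ⟨hb, hc, hbc⟩ := hc
    have key : ∀ U₁ : A → List B, (∀ i, IsSpun (U₁ i) (V i)) →
        ∀ U₂ : A → List B, (∀ i, IsSpun (U₂ i) (V i)) →
        ((∃ i ∈ b, U₁ i ≠ V i) ∨ ∃ i ∈ c.flatten, U₂ i ≠ V i) →
        G (b.flatMap U₁ :: expand U₂ c) ∈ N := by
      intro U₁ h₁ U₂ h₂ hne
      let U : A → List B := fun i => if i ∈ b then U₁ i else U₂ i
      have e₁ : ∀ i ∈ b, U i = U₁ i := fun i hi => if_pos hi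
      have e₂ : ∀ i ∈ c.flatten, U i = U₂ i := fun i hi =>
        if_neg fun hi' => hbc i hi' i hi rfl
      have h := hG U (fun i => by simp only [U]; split_ifs; exacts [h₁ i, h₂ i]) (by
        rcases hne with ⟨i, hi, hne⟩ | ⟨i, hi, hne⟩
        · exact ⟨i, by simp [hi], by rwa [e₁ i hi]⟩
        · exact ⟨i, by rw [List.flatten_cons]; exact List.mem_append_right _ hi,
            by rwa [e₂ i hi]⟩)
      have e : expand U (b :: c) = b.flatMap U₁ :: expand U₂ c := by
        rw [expand, List.map_cons, List.flatMap_congr e₁]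
        congr 1
        exact List.map_congr_left fun d hd => List.flatMap_congr fun i hi =>
          e₂ i (List.mem_flatten.2 ⟨d, hd, hi⟩)
      rwa [e] at h
    have hc' : ∀ U : A → List B, (∀ i, IsSpun (U i) (V i)) →
        termSum (spinBlocks (c.map fun b => b.map V)) (fun f => G (b.flatMap U :: f)) -
          G (b.flatMap U :: expand V c) ∈ N := fun U hU =>
      ih hc _ fun U' hU' hne => key U hU U' hU' (Or.inr hne)
    have h1 := termSum_spinBlock_sub_mem N V hV hb
      (fun l => termSum (spinBlocks (c.map fun b => b.map V)) fun f => G (l :: f))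
      fun U hU hne => by
        have := N.add_mem (hc' U hU) (key U hU V (fun _ => Or.inl rfl) (Or.inl hne))
        rwa [sub_add_cancel] at this
    rw [List.map_cons, termSum_spinBlocks_cons]
    have := N.add_mem h1 (hc' V fun _ => Or.inl rfl)
    rwa [sub_add_sub_cancel] at this

end Expand

/-! ### The symbols first reached by a permutation -/

section Layers

theorem flatMap_filter {A B : Type} (p : A → Bool) (U : A → List B) (l : List A) :
    (l.filter p).flatMap U = l.flatMap fun i => if p i then U i else [] := by
  induction l with
  | nil => rfl
  | cons i l ih => by_cases h : p i <;> simp [h, ih]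

variable {n : ℕ}

theorem nodup_word (σ : Equiv.Perm (Fin n)) : (word σ).Nodup :=
  List.nodup_ofFn.2 σ.injective

theorem mem_word (σ : Equiv.Perm (Fin n)) (x : Fin n) : x ∈ word σ :=
  (List.mem_ofFn' _ _).2 (σ.surjective x)

theorem length_word (σ : Equiv.Perm (Fin n)) : (word σ).length = n := List.length_ofFn

theorem exists_word_eq {l : List (Fin n)} (hl : l.Nodup) (hm : ∀ x, x ∈ l) :
    ∃ τ : Equiv.Perm (Fin n), word τ = l := by
  have hn : l.length = n := by
    have := ((List.perm_ext_iff_of_nodup hl (List.nodup_finRange n)).2 (by simp [hm])).length_eq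
    simpa using this
  let f : Fin n → Fin n := fun i => l.get (i.cast hn.symm)
  have hf : Function.Injective f := fun i j h => by
    simpa using hl.get_inj_iff.1 h
  refine ⟨Equiv.ofBijective f (Finite.injective_iff_bijective.1 hf), ?_⟩
  refine List.ext_get (by simp [word, hn]) fun i h₁ h₂ => ?_
  simp [word, f]

theorem word_lt_word_iff (τ σ : Equiv.Perm (Fin n)) :
    word τ < word σ ↔ toLex (τ : Fin n → Fin n) < toLex (σ : Fin n → Fin n) :=
  ofFn_lt_ofFn_iff _ _

variable (σ : Equiv.Perm (Fin n))

/-- The wheels of a permutation, as a family of words. -/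
def wheel (i : Fin (wheelsOf σ).length) : List (Fin n) := (wheelsOf σ).get i

theorem flatMap_wheel : (List.finRange (wheelsOf σ).length).flatMap (wheel σ) = word σ := by
  rw [List.flatMap_def]
  unfold wheel
  rw [List.map_get_finRange, wheelsOf, flatten_wheels]

theorem exists_axle_wheel (i : Fin (wheelsOf σ).length) :
    ∃ a t, wheel σ i = a :: t ∧ ∀ x ∈ t, x < a :=
  exists_axle (List.get_mem _ i)

theorem wheel_ne_nil (i : Fin (wheelsOf σ).length) : wheel σ i ≠ [] := by
  obtain ⟨a, t, h, -⟩ := exists_axle_wheel σ i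
  simp [h]

theorem eq_of_mem_wheel {i j : Fin (wheelsOf σ).length} {x : Fin n} (hi : x ∈ wheel σ i)
    (hj : x ∈ wheel σ j) : i = j := by
  by_contra h
  have hn := nodup_word σ
  rw [← flatMap_wheel, List.nodup_flatMap] at hn
  have : Std.Symm (Function.onFun List.Disjoint (wheel σ)) := ⟨fun _ _ h => List.Disjoint.symm h⟩
  exact hn.2.forall (List.mem_finRange i) (List.mem_finRange j) h hi hj

theorem expand_wheel_injective : Function.Injective (expand (wheel σ)) := by
  refine expand_injective (wheel_ne_nil σ) fun i j h => ?_
  obtain ⟨a, t, hi, -⟩ := exists_axle_wheel σ i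
  obtain ⟨b, s, hj, -⟩ := exists_axle_wheel σ j
  rw [hi, hj] at h
  obtain rfl : a = b := by simpa using h
  exact eq_of_mem_wheel σ (x := a) (by simp [hi]) (by simp [hj])

theorem sublist_finRange_of_pairwise {m : ℕ} {b : List (Fin m)} (hb : b.Pairwise (· < ·)) :
    b.Sublist (List.finRange m) := by
  have : b = (List.finRange m).filter (· ∈ b) :=
    hb.eq_of_mem_iff ((List.pairwise_lt_finRange m).filter _) (by simp)
  rw [this]
  exact List.filter_sublist

theorem perm_finRange {m : ℕ} {c : List (List (Fin m))} (hc : IsSymbol c) :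
    c.flatten.Perm (List.finRange m) :=
  (List.perm_ext_iff_of_nodup hc.2.1 (List.nodup_finRange m)).2 (by simpa using hc.2.2)

variable {σ} {w : ℕ}

theorem expand_mem_cel {c : List (List (Fin (wheelsOf σ).length))}
    (hc : c ∈ (wheelPerm σ w).cells) {U : Fin (wheelsOf σ).length → List (Fin n)}
    (hU : ∀ i, (U i).Perm (wheel σ i)) {τ : Equiv.Perm (Fin n)}
    (hτ : word τ = (List.finRange (wheelsOf σ).length).flatMap U) :
    expand U c ∈ (cel (Fin n) w).cells ∧ ∀ b ∈ expand U c, b.Sublist (word τ) := by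
  obtain ⟨hs, hlt, hw⟩ := hc
  have hp : (expand U c).flatten.Perm (word τ) := by
    rw [flatten_expand, hτ]
    exact (perm_finRange hs).flatMap_right U
  refine ⟨⟨⟨?_, hp.nodup_iff.2 (nodup_word τ), fun x => hp.mem_iff.2 (mem_word τ x)⟩, ?_⟩, ?_⟩
  · intro b hb
    obtain ⟨b, hb', rfl⟩ := List.mem_map.1 hb
    intro h
    obtain ⟨i, hi⟩ := List.exists_mem_of_ne_nil b (hs.1 b hb')
    have h0 : U i = [] := List.flatMap_eq_nil_iff.1 h i hi
    have := hU i
    rw [h0] at this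
    exact wheel_ne_nil σ i this.nil_eq.symm
  · intro b hb
    obtain ⟨b, hb', rfl⟩ := List.mem_map.1 hb
    refine le_of_eq_of_le ?_ (hw b hb')
    rw [List.length_flatMap]
    congr 1
    exact List.map_congr_left fun i _ => (hU i).length_eq
  · intro b hb
    obtain ⟨b, hb', rfl⟩ := List.mem_map.1 hb
    rw [hτ]
    exact (sublist_finRange_of_pairwise (hlt b hb')).flatMap U

theorem cellDim_expand {c : List (List (Fin (wheelsOf σ).length))}
    (U : Fin (wheelsOf σ).length → List (Fin n)) {k : ℤ} :
    cellDim (expand U c) = k ↔ cellDim c = k - spinDim σ := by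
  -- Insertion keeps the number of blocks, so the dimensions differ by `n` minus the number of
  -- wheels; the bound makes the truncated subtraction in `spinDim` exact.
  have := length_wheels_le (word σ)
  rw [length_word, ← wheelsOf] at this
  simp only [cellDim, expand, List.length_map, Fintype.card_fin, spinDim]
  omega

theorem expand_mem_layerLE {c : List (List (Fin (wheelsOf σ).length))}
    (hc : c ∈ (wheelPerm σ w).cells) : expand (wheel σ) c ∈ (layerLE σ w).cells := by
  have h := expand_mem_cel hc (fun i => List.Perm.refl (wheel σ i)) (flatMap_wheel σ).symm
  exact ⟨h.1, σ, Set.mem_ofPred.2 le_rfl, h.2⟩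

theorem expand_mem_layerLT {c : List (List (Fin (wheelsOf σ).length))}
    (hc : c ∈ (wheelPerm σ w).cells) {U : Fin (wheelsOf σ).length → List (Fin n)}
    (hU : ∀ i, IsSpun (U i) (wheel σ i)) (hne : ∃ i, U i ≠ wheel σ i) :
    expand U c ∈ (layerLT σ w).cells := by
  have hp : ((List.finRange (wheelsOf σ).length).flatMap U).Perm (word σ) := by
    rw [← flatMap_wheel]
    exact List.Perm.flatMap_left _ fun i _ => (hU i).perm
  obtain ⟨τ, hτ⟩ := exists_word_eq (hp.nodup_iff.2 (nodup_word σ))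
    fun x => hp.mem_iff.2 (mem_word σ x)
  have h := expand_mem_cel hc (fun i => (hU i).perm) hτ
  refine ⟨h.1, τ, Set.mem_ofPred.2 ?_, h.2⟩
  rw [← word_lt_word_iff, hτ, ← flatMap_wheel]
  obtain ⟨i, hi⟩ := hne
  exact flatMap_lt_flatMap hU ⟨i, by simp, hi⟩

/-- Let `τ < σ` contain the symbol, and let `x < y` be the entries of `τ` and `σ` at the first
difference. In `σ` the letter `x` comes after `y`, so it is not a record, and its predecessor `z` is
in its wheel and not in the common prefix. Then `z` precedes `x` in a block, hence in `τ`, whereas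
only letters of the prefix precede `x` there. -/
theorem expand_notMem_layerLT {c : List (List (Fin (wheelsOf σ).length))}
    (hc : c ∈ (wheelPerm σ w).cells) : expand (wheel σ) c ∉ (layerLT σ w).cells := by
  rintro ⟨-, τ, hτ, hs⟩
  have hlt := (word_lt_word_iff τ σ).2 (Set.mem_ofPred.1 hτ)
  obtain ⟨p, x, y, r, s, hτw, hσw, hxy⟩ :=
    exists_of_lt_of_length_eq hlt (by rw [length_word, length_word])
  have hτn := nodup_word τ
  have hσn := nodup_word σ
  rw [hτw] at hτn
  have hxs : x ∈ s := by
    have := mem_word σ x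
    rw [hσw, List.mem_append, List.mem_cons] at this
    rcases this with h | h | h
    · exact absurd rfl ((List.nodup_append.1 hτn).2.2 x h x (by simp))
    · exact absurd h hxy.ne
    · exact h
  obtain ⟨r₁, r₂, rfl⟩ := List.append_of_mem hxs
  obtain ⟨v, hv, z, hz, hzx⟩ := exists_pair_sublist_wheel hσn hσw hxy
  obtain ⟨i, rfl⟩ := List.mem_iff_get.1 hv
  obtain ⟨b, hb, hi⟩ := List.exists_of_mem_flatten (hc.1.2.2 i)
  have hsub : [z, x].Sublist (p ++ x :: r) := by
    rw [← hτw]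
    refine hzx.trans (List.Sublist.trans ?_ (hs _ (List.mem_map_of_mem hb)))
    rw [List.flatMap_def]
    exact List.sublist_flatten_of_mem (List.mem_map_of_mem hi)
  obtain ⟨l₁, l₂, he, h₁, h₂⟩ := List.sublist_append_iff.1 hsub
  rcases l₁ with _ | ⟨z', l₁⟩
  · rw [List.nil_append] at he
    rw [← he] at h₂
    have hxr : x ∈ r := by
      rcases List.cons_sublist_cons'.1 h₂ with h | ⟨-, h⟩
      · exact h.mem (by simp)
      · exact h.mem (by simp)
    exact (List.nodup_cons.1 (List.nodup_append.1 hτn).2.1).1 hxr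
  · obtain ⟨rfl, -⟩ := List.cons_eq_cons.1 he
    rw [hσw] at hσn
    refine (List.nodup_append.1 hσn).2.2 z (h₁.mem (by simp)) z ?_ rfl
    rcases List.mem_cons.1 hz with rfl | hz
    · simp
    · simp [hz]

/-- In a symbol first reached by `σ`, no wheel of `σ` is broken up. -/
theorem mem_block_of_axle_mem {f : List (List (Fin n))} (hf : f ∈ (layerLE σ w).cells)
    (hf' : f ∉ (layerLT σ w).cells) {i : Fin (wheelsOf σ).length} {a : Fin n} {t : List (Fin n)}
    (hi : wheel σ i = a :: t) (hlt : ∀ x ∈ t, x < a) {b : List (Fin n)} (hb : b ∈ f)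
    (ha : a ∈ b) : ∀ x ∈ t, x ∈ b := by
  obtain ⟨hcel, τ, hτ, hs⟩ := hf
  obtain rfl : τ = σ := by
    rcases (Set.mem_ofPred.1 hτ).lt_or_eq with h | h
    · exact absurd ⟨hcel, τ, Set.mem_ofPred.2 h, hs⟩ hf'
    · exact DFunLike.coe_injective (toLex.injective h)
  by_contra hx
  obtain ⟨t₁, x, t₂, rfl, h₁, hxb⟩ := exists_first_not hx
  obtain ⟨p, q, hpq⟩ := List.append_of_mem (List.mem_finRange i)
  have hw : word τ = p.flatMap (wheel τ) ++ ((a :: t₁) ++ x :: (t₂ ++ q.flatMap (wheel τ))) := by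
    rw [← flatMap_wheel, hpq, List.flatMap_append, List.flatMap_cons, hi]
    simp
  generalize p.flatMap (wheel τ) = P at hw
  generalize t₂ ++ q.flatMap (wheel τ) = Q at hw
  -- Moving `x`, the first letter of the wheel outside `b`, in front of the axle gives a smaller
  -- permutation. It still contains every block, since the letters that `x` passes all lie in `b`
  -- and `x` does not.
  have hp : (P ++ x :: ((a :: t₁) ++ Q)).Perm (word τ) := by
    rw [hw]
    exact List.Perm.append_left _ List.perm_middle.symm
  obtain ⟨ρ, hρ⟩ := exists_word_eq (hp.nodup_iff.2 (nodup_word τ))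
    fun x => hp.mem_iff.2 (mem_word τ x)
  refine hf' ⟨hcel, ρ, Set.mem_ofPred.2 ?_, fun c hc => ?_⟩
  · rw [← word_lt_word_iff, hρ, hw]
    exact List.append_left_lt (List.cons_lt_cons_iff.2 (Or.inl (hlt x (by simp))))
  · rw [eq_filter_of_sublist (hs c hc) (nodup_word τ)]
    have : (word τ).filter (· ∈ c) = (word ρ).filter (· ∈ c) := by
      rw [hρ, hw]
      by_cases hxc : x ∈ c
      · have : (a :: t₁).filter (· ∈ c) = [] := by
          simp only [List.filter_eq_nil_iff, decide_eq_true_eq]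
          intro y hy hyc
          have hyb : y ∈ b := by
            rcases List.mem_cons.1 hy with rfl | hy
            · exact ha
            · exact h₁ y hy
          rw [eq_of_mem_of_nodup_flatten hcel.1.2.1 hb hc hyb hyc] at hxb
          exact hxb hxc
        rw [List.filter_append, List.filter_append, this, List.filter_append,
          List.filter_cons, List.filter_cons, List.filter_append, this]
        simp
      · simp [List.filter_append, List.filter_cons, hxc]
    rw [this]
    exact List.filter_sublist

/-- Each wheel lies in the block of its axle. A block is thus a union of whole wheels, and being a
subword of `σ` it lists them in order, so the axles it contains determine it. -/
theorem exists_expand_eq {f : List (List (Fin n))} (hf : f ∈ (layerLE σ w).cells)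
    (hf' : f ∉ (layerLT σ w).cells) :
    ∃ c ∈ (wheelPerm σ w).cells, expand (wheel σ) c = f := by
  have hcel := hf.1
  choose a t hat hlt using exists_axle_wheel σ
  have hall : ∀ b ∈ f, ∀ i, ∀ x ∈ wheel σ i, x ∈ b ↔ a i ∈ b := by
    intro b hb i x hx
    constructor
    · intro hxb
      obtain ⟨c, hc, hac⟩ := List.exists_of_mem_flatten (hcel.1.2.2 (a i))
      have hxc : x ∈ c := by
        rw [hat] at hx
        rcases List.mem_cons.1 hx with rfl | hx
        · exact hac
        · exact mem_block_of_axle_mem hf hf' (hat i) (hlt i) hc hac x hx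
      rwa [eq_of_mem_of_nodup_flatten hcel.1.2.1 hb hc hxb hxc]
    · intro hab
      rw [hat] at hx
      rcases List.mem_cons.1 hx with rfl | hx
      · exact hab
      · exact mem_block_of_axle_mem hf hf' (hat i) (hlt i) hb hab x hx
  let g : List (Fin n) → List (Fin (wheelsOf σ).length) := fun b =>
    (List.finRange _).filter fun i => a i ∈ b
  have hsub : ∀ b ∈ f, b.Sublist (word σ) := by
    obtain ⟨-, τ, hτ, hs⟩ := hf
    rcases (Set.mem_ofPred.1 hτ).lt_or_eq with h | h
    · exact absurd ⟨hcel, τ, Set.mem_ofPred.2 h, hs⟩ hf'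
    · rwa [DFunLike.coe_injective (toLex.injective h)] at hs
  have hg : ∀ b ∈ f, (g b).flatMap (wheel σ) = b := by
    intro b hb
    conv_rhs => rw [eq_filter_of_sublist (hsub b hb) (nodup_word σ), ← flatMap_wheel,
      List.filter_flatMap]
    rw [flatMap_filter]
    refine List.flatMap_congr fun i _ => ?_
    have h := hall b hb i
    by_cases hab : a i ∈ b
    · rw [if_pos (by simpa using hab)]
      exact (List.filter_eq_self.2 fun x hx => by simpa using (h x hx).2 hab).symm
    · rw [if_neg (by simpa using hab)]
      exact (List.filter_eq_nil_iff.2 fun x hx => by simpa using fun hx' => hab ((h x hx).1 hx')).symm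
  have he : expand (wheel σ) (f.map g) = f := by
    rw [expand, List.map_map]
    conv_rhs => rw [← List.map_id f]
    exact List.map_congr_left hg
  refine ⟨f.map g, ⟨⟨?_, ?_, ?_⟩, ?_, ?_⟩, he⟩
  · intro b hb
    obtain ⟨b, hb', rfl⟩ := List.mem_map.1 hb
    intro h
    have := hg b hb'
    rw [h] at this
    exact hcel.1.1 b hb' this.symm
  · have := hcel.1.2.1
    rw [← he, flatten_expand, List.nodup_flatMap] at this
    refine this.2.imp fun {i j} hij => ?_
    rintro rfl
    exact hij (a := a i) (by simp [hat]) (by simp [hat])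
  · intro i
    obtain ⟨b, hb, hab⟩ := List.exists_of_mem_flatten (hcel.1.2.2 (a i))
    exact List.mem_flatten.2 ⟨g b, List.mem_map_of_mem hb, by simp [g, hab]⟩
  · intro b hb
    obtain ⟨b, hb', rfl⟩ := List.mem_map.1 hb
    exact (List.pairwise_lt_finRange _).filter _
  · intro b hb
    obtain ⟨b, hb', rfl⟩ := List.mem_map.1 hb
    refine le_of_eq_of_le ?_ (hcel.2 b hb')
    conv_rhs => rw [← hg b hb']
    rw [List.length_flatMap]
    rfl

theorem exists_mem_layers {f : List (List (Fin n))} (hf : f ∈ (cel (Fin n) w).cells) :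
    ∃ σ : Equiv.Perm (Fin n), f ∈ (layerLE σ w).cells := by
  obtain ⟨τ, hτ⟩ := exists_word_eq hf.1.2.1 hf.1.2.2
  refine ⟨τ, hf, τ, Set.mem_ofPred.2 le_rfl, fun b hb => ?_⟩
  rw [hτ]
  exact List.sublist_flatten_of_mem hb

end Layers

/-! ### Degreewise direct sums of complexes and their homology -/

section Homology

variable {R : Type} [Ring R] {C : ChainComplex (ModuleCat.{0} R) ℤ}

/-- The degreewise projections are automatically chain maps, so `C` is a biproduct of complexes, and
the additive functor homology preserves the biproduct identities. -/
theorem bijective_coprod_homologyMap {K L : ChainComplex (ModuleCat.{0} R) ℤ} (f : K ⟶ C)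
    (g : L ⟶ C) (h : ∀ k, Function.Bijective (LinearMap.coprod (f.f k).hom (g.f k).hom)) (j : ℤ) :
    Function.Bijective (LinearMap.coprod (HomologicalComplex.homologyMap f j).hom
      (HomologicalComplex.homologyMap g j).hom) := by
  let e := fun k => LinearEquiv.ofBijective (LinearMap.coprod (f.f k).hom (g.f k).hom) (h k)
  have he : ∀ k a b, e k (a, b) = (f.f k).hom a + (g.f k).hom b := fun k a b => rfl
  have hd : ∀ i j (x : C.X i), (e j).symm ((C.d i j).hom x) =
      ((K.d i j).hom ((e i).symm x).1, (L.d i j).hom ((e i).symm x).2) := by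
    intro i j x
    obtain ⟨⟨a, b⟩, rfl⟩ := (e i).surjective x
    rw [LinearEquiv.symm_apply_apply, LinearEquiv.symm_apply_eq, he, he, map_add]
    have h₁ := congrArg (fun φ => φ.hom a) (f.comm i j)
    have h₂ := congrArg (fun φ => φ.hom b) (g.comm i j)
    simp only [ModuleCat.hom_comp, LinearMap.comp_apply] at h₁ h₂
    rw [h₁, h₂]
  let p : C ⟶ K :=
    { f := fun k => ModuleCat.ofHom (LinearMap.fst R _ _ ∘ₗ (e k).symm.toLinearMap)
      comm' := fun i j _ => ModuleCat.hom_ext <| LinearMap.ext fun x =>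
        (congrArg Prod.fst (hd i j x)).symm }
  let q : C ⟶ L :=
    { f := fun k => ModuleCat.ofHom (LinearMap.snd R _ _ ∘ₗ (e k).symm.toLinearMap)
      comm' := fun i j _ => ModuleCat.hom_ext <| LinearMap.ext fun x =>
        (congrArg Prod.snd (hd i j x)).symm }
  have hf : ∀ k a, (e k).symm ((f.f k).hom a) = (a, 0) := fun k a => by
    rw [LinearEquiv.symm_apply_eq, he, map_zero, add_zero]
  have hg : ∀ k b, (e k).symm ((g.f k).hom b) = (0, b) := fun k b => by
    rw [LinearEquiv.symm_apply_eq, he, map_zero, zero_add]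
  have hfp : f ≫ p = 𝟙 K := by
    ext k a
    exact congrArg Prod.fst (hf k a)
  have hfq : f ≫ q = 0 := by
    ext k a
    exact congrArg Prod.snd (hf k a)
  have hgp : g ≫ p = 0 := by
    ext k a
    exact congrArg Prod.fst (hg k a)
  have hgq : g ≫ q = 𝟙 L := by
    ext k a
    exact congrArg Prod.snd (hg k a)
  have hpq : p ≫ f + q ≫ g = 𝟙 C := by
    ext k x
    exact (e k).apply_symm_apply x
  replace hfp := congrArg (fun φ : K ⟶ K => (HomologicalComplex.homologyMap φ j).hom) hfp
  replace hfq := congrArg (fun φ : K ⟶ L => (HomologicalComplex.homologyMap φ j).hom) hfq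
  replace hgp := congrArg (fun φ : L ⟶ K => (HomologicalComplex.homologyMap φ j).hom) hgp
  replace hgq := congrArg (fun φ : L ⟶ L => (HomologicalComplex.homologyMap φ j).hom) hgq
  replace hpq := congrArg (fun φ : C ⟶ C => (HomologicalComplex.homologyMap φ j).hom) hpq
  simp only [HomologicalComplex.homologyMap_comp, HomologicalComplex.homologyMap_add,
    HomologicalComplex.homologyMap_id, HomologicalComplex.homologyMap_zero, ModuleCat.hom_comp,
    ModuleCat.hom_add, ModuleCat.hom_id, ModuleCat.hom_zero] at hfp hfq hgp hgq hpq
  constructor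
  · rw [injective_iff_map_eq_zero]
    rintro ⟨a, b⟩ hab
    rw [LinearMap.coprod_apply] at hab
    have h₁ := congrArg (HomologicalComplex.homologyMap p j).hom hab
    have h₂ := congrArg (HomologicalComplex.homologyMap q j).hom hab
    rw [map_add, map_zero, ← LinearMap.comp_apply, ← LinearMap.comp_apply] at h₁ h₂
    rw [hfp, hgp] at h₁
    rw [hfq, hgq] at h₂
    simp only [LinearMap.id_apply, LinearMap.zero_apply, add_zero, zero_add] at h₁ h₂
    rw [h₁, h₂]
    rfl
  · intro x
    exact ⟨((HomologicalComplex.homologyMap p j).hom x, (HomologicalComplex.homologyMap q j).hom x),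
      LinearMap.congr_fun hpq x⟩

/-- The same argument for a finite family; finiteness allows the identity of `C` to be written as `∑
i, p i ≫ f i`. -/
theorem bijective_toModule_homologyMap {ι : Type} [Fintype ι] [DecidableEq ι]
    {K : ι → ChainComplex (ModuleCat.{0} R) ℤ} (f : ∀ i, K i ⟶ C)
    (h : ∀ k, Function.Bijective
      (DirectSum.toModule R ι (C.X k) fun i => ((f i).f k).hom)) (j : ℤ) :
    Function.Bijective (DirectSum.toModule R ι (C.homology j) fun i =>
      (HomologicalComplex.homologyMap (f i) j).hom) := by
  let e := fun k => LinearEquiv.ofBijective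
    (DirectSum.toModule R ι (C.X k) fun i => ((f i).f k).hom) (h k)
  have he : ∀ k i a, e k (DirectSum.lof R ι (fun i => (K i).X k) i a) = ((f i).f k).hom a :=
    fun k i a => DirectSum.toModule_lof _ _ _
  have hf : ∀ k i a, (e k).symm (((f i).f k).hom a) = DirectSum.lof R ι _ i a := fun k i a => by
    rw [LinearEquiv.symm_apply_eq, he]
  have hd : ∀ i j l (x : C.X i), DirectSum.component R ι _ l ((e j).symm ((C.d i j).hom x)) =
      ((K l).d i j).hom (DirectSum.component R ι _ l ((e i).symm x)) := by
    intro i j l x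
    obtain ⟨y, rfl⟩ := (e i).surjective x
    rw [LinearEquiv.symm_apply_apply]
    induction y using DirectSum.induction_on with
    | zero => simp
    | add y z hy hz => simp only [map_add, hy, hz]
    | of m a =>
      rw [← DirectSum.lof_eq_of R, he]
      have h₁ := congrArg (fun φ => φ.hom a) ((f m).comm i j)
      simp only [ModuleCat.hom_comp, LinearMap.comp_apply] at h₁
      rw [h₁, hf, DirectSum.component.of, DirectSum.component.of]
      split_ifs with hml
      · subst hml; rfl
      · simp
  let p : ∀ l, C ⟶ K l := fun l =>
    { f := fun k => ModuleCat.ofHom (DirectSum.component R ι _ l ∘ₗ (e k).symm.toLinearMap)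
      comm' := fun i j _ => ModuleCat.hom_ext <| LinearMap.ext fun x => (hd i j l x).symm }
  have hfp : ∀ i, f i ≫ p i = 𝟙 (K i) := by
    intro i
    ext k a
    refine (congrArg (DirectSum.component R ι _ i) (hf k i a)).trans ?_
    exact DirectSum.component.lof_self ..
  have hfq : ∀ i l, i ≠ l → f i ≫ p l = 0 := by
    intro i l hil
    ext k a
    refine (congrArg (DirectSum.component R ι _ l) (hf k i a)).trans ?_
    rw [DirectSum.component.of, dif_neg hil]
    rfl
  have hpf : ∑ i, p i ≫ f i = 𝟙 C := by
    ext k x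
    obtain ⟨y, rfl⟩ := (e k).surjective x
    have h₁ : (∑ i, p i ≫ f i).f k = ∑ i, (p i ≫ f i).f k :=
      (HomologicalComplex.eval (ModuleCat R) (ComplexShape.down ℤ) k).map_sum
        (fun i => p i ≫ f i) Finset.univ
    rw [h₁, ModuleCat.hom_sum, LinearMap.sum_apply]
    refine Eq.trans (b := ∑ i, e k (DirectSum.lof R ι _ i (DirectSum.component R ι _ i y))) ?_ ?_
    · refine Finset.sum_congr rfl fun i _ => ?_
      rw [he]
      exact congrArg (fun z => ((f i).f k).hom (DirectSum.component R ι _ i z))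
        ((e k).symm_apply_apply y)
    · rw [← map_sum]
      exact congrArg (e k) (DirectSum.sum_univ_of y)
  have hH : ∀ i l (x : (K i).homology j), (HomologicalComplex.homologyMap (p l) j).hom
      ((HomologicalComplex.homologyMap (f i) j).hom x) =
        DirectSum.component R ι _ l (DirectSum.lof R ι (fun i => (K i).homology j) i x) := by
    intro i l x
    rw [← LinearMap.comp_apply, ← ModuleCat.hom_comp, ← HomologicalComplex.homologyMap_comp,
      DirectSum.component.of]
    split_ifs with hil
    · subst hil
      rw [hfp, HomologicalComplex.homologyMap_id]
      rfl
    · rw [hfq i l hil, HomologicalComplex.homologyMap_zero]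
      rfl
  constructor
  · rw [injective_iff_map_eq_zero]
    intro y hy
    have key : ∀ l (y : ⨁ i, (K i).homology j), (HomologicalComplex.homologyMap (p l) j).hom
        (DirectSum.toModule R ι (C.homology j)
          (fun i => (HomologicalComplex.homologyMap (f i) j).hom) y) =
        DirectSum.component R ι _ l y := by
      intro l y
      induction y using DirectSum.induction_on with
      | zero => simp
      | add y z hy hz => simp only [map_add, hy, hz]
      | of m a => rw [← DirectSum.lof_eq_of R, DirectSum.toModule_lof, hH]
    refine DirectSum.ext_component R fun l => ?_
    rw [← key, hy, map_zero, map_zero]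
  · intro x
    refine ⟨∑ i, DirectSum.lof R ι _ i ((HomologicalComplex.homologyMap (p i) j).hom x), ?_⟩
    rw [map_sum]
    simp only [DirectSum.toModule_lof]
    have h₁ : HomologicalComplex.homologyMap (∑ i, p i ≫ f i) j =
        ∑ i, HomologicalComplex.homologyMap (p i ≫ f i) j :=
      (HomologicalComplex.homologyFunctor (ModuleCat R) (ComplexShape.down ℤ) j).map_sum
        (fun i => p i ≫ f i) Finset.univ
    rw [hpf] at h₁
    replace h₁ := congrArg (fun φ : C.homology j ⟶ C.homology j => φ.hom x) h₁
    simp only [HomologicalComplex.homologyMap_comp,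
      HomologicalComplex.homologyMap_id, ModuleCat.hom_sum, LinearMap.sum_apply,
      ModuleCat.hom_comp, LinearMap.comp_apply] at h₁
    exact h₁.symm

/-- The homology of a shifted complex. -/
noncomputable def shiftHomologyEquiv (K : ChainComplex (ModuleCat.{0} ℤ) ℤ) (r : ℕ) (j : ℤ) :
    (shift K r).homology j ≃+ K.homology (j - r) :=
  let e₁ := (shift K r).isoSc' (j + 1) j (j - 1) (by simp) (by simp)
  -- The neighbouring degrees are written so that this short complex agrees definitionally with that
  -- of the shift.
  let e₂ := K.isoSc' (j + 1 - r) (j - r) (j - 1 - r) (by simp; ring) (by simp; ring)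
  (ShortComplex.homologyMapIso e₁ ≪≫ (ShortComplex.homologyMapIso e₂).symm).toLinearEquiv.toAddEquiv

end Homology
-- The spinning map and the splitting of chains
section SpinMap

variable {n : ℕ} (σ : Equiv.Perm (Fin n)) {w : ℕ}

theorem spinCell_eq (c : List (List (Fin (wheelsOf σ).length))) :
    spinCell σ c = spinSum (wheel σ) c := by
  unfold spinCell spinSum termSum
  simp only [Finsupp.smul_single, smul_eq_mul, mul_one]
  rfl

theorem chains_layerLT_le (k : ℤ) : (layerLT σ w).chains k ≤ (layerLE σ w).chains k :=
  Finsupp.supported_mono fun _ hf => ⟨layerLT_subset_layerLE σ w hf.1, hf.2⟩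

variable {σ}

theorem spinSum_sub_mem {c : List (List (Fin (wheelsOf σ).length))} {k : ℤ}
    (hc : c ∈ (wheelPerm σ w).cells) (hk : cellDim c = k - spinDim σ) :
    spinSum (wheel σ) c - Finsupp.single (expand (wheel σ) c) 1 ∈ (layerLT σ w).chains k := by
  refine termSum_spinBlocks_sub_mem _ (wheel σ) (exists_axle_wheel σ) hc.1.2.1
    (fun f => Finsupp.single f (1 : ℤ)) fun U hU hne => ?_
  obtain ⟨i, -, hi⟩ := hne
  exact Finsupp.single_mem_supported ℤ _
    ⟨expand_mem_layerLT hc hU ⟨i, hi⟩, (cellDim_expand U).2 hk⟩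

/-- The sign of a cell in the spinning map. -/
def spinSign (σ : Equiv.Perm (Fin n)) (c : List (List (Fin (wheelsOf σ).length))) : ℤˣ :=
  (-1) ^ spinExp (fun i => (wheel σ i).length) c

theorem spinChain_apply (z : List (List (Fin (wheelsOf σ).length)) →₀ ℤ) :
    spinChain (wheel σ) z =
      Finsupp.linearCombination ℤ (fun c => (spinSign σ c : ℤ) • spinSum (wheel σ) c) z := by
  simp [spinChain, spinSign]

/-- The leading term of the spinning map. -/
noncomputable def leadingTerm (σ : Equiv.Perm (Fin n)) :
    (List (List (Fin (wheelsOf σ).length)) →₀ ℤ) →ₗ[ℤ] (List (List (Fin n)) →₀ ℤ) :=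
  Finsupp.linearCombination ℤ fun c =>
    (spinSign σ c : ℤ) • Finsupp.single (expand (wheel σ) c) 1

theorem leadingTerm_apply_expand (z : List (List (Fin (wheelsOf σ).length)) →₀ ℤ)
    (c : List (List (Fin (wheelsOf σ).length))) :
    leadingTerm σ z (expand (wheel σ) c) = spinSign σ c * z c := by
  induction z using Finsupp.induction_linear with
  | zero => simp
  | add x y hx hy => rw [map_add, Finsupp.add_apply, hx, hy, Finsupp.add_apply, mul_add]
  | single d a =>
    classical
    rw [leadingTerm, Finsupp.linearCombination_single]
    by_cases h : d = c
    · subst h; simp [mul_comm]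
    · simp [h, (expand_wheel_injective σ).ne h]

theorem spinChain_sub_leadingTerm_mem {k : ℤ} {z : List (List (Fin (wheelsOf σ).length)) →₀ ℤ}
    (hz : z ∈ (wheelPerm σ w).chains (k - spinDim σ)) :
    spinChain (wheel σ) z - leadingTerm σ z ∈ (layerLT σ w).chains k := by
  rw [spinChain_apply, leadingTerm, Finsupp.linearCombination_apply,
    Finsupp.linearCombination_apply, Finsupp.sum, Finsupp.sum, ← Finset.sum_sub_distrib]
  refine Submodule.sum_mem _ fun c hc => ?_
  rw [← smul_sub, ← smul_sub]
  obtain ⟨hcP, hk⟩ := (Finsupp.mem_supported ℤ z).1 hz hc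
  exact Submodule.smul_mem _ _ (Submodule.smul_mem _ _ (spinSum_sub_mem hcP hk))

theorem leadingTerm_mem {k : ℤ} {z : List (List (Fin (wheelsOf σ).length)) →₀ ℤ}
    (hz : z ∈ (wheelPerm σ w).chains (k - spinDim σ)) :
    leadingTerm σ z ∈ (layerLE σ w).chains k := by
  rw [leadingTerm, Finsupp.linearCombination_apply]
  refine Submodule.sum_mem _ fun c hc => ?_
  obtain ⟨hcP, hk⟩ := (Finsupp.mem_supported ℤ z).1 hz hc
  exact Submodule.smul_mem _ _ (Submodule.smul_mem _ _ (Finsupp.single_mem_supported ℤ _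
    ⟨expand_mem_layerLE hcP, (cellDim_expand _).2 hk⟩))

theorem spinChain_mem {k : ℤ} : ∀ z ∈ (wheelPerm σ w).chains (k - spinDim σ),
    spinChain (wheel σ) z ∈ (layerLE σ w).chains k := by
  intro z hz
  have := Submodule.add_mem _ (chains_layerLT_le σ k (spinChain_sub_leadingTerm_mem hz))
    (leadingTerm_mem hz)
  rwa [sub_add_cancel] at this

/-- The leading terms of distinct cells are, up to sign, distinct symbols outside `L(< σ)`, so none
of them can cancel or be absorbed. -/
theorem eq_zero_of_spinChain_mem {k : ℤ} {z : List (List (Fin (wheelsOf σ).length)) →₀ ℤ}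
    (hz : z ∈ (wheelPerm σ w).chains (k - spinDim σ))
    (h : spinChain (wheel σ) z ∈ (layerLT σ w).chains k) : z = 0 := by
  have hl : leadingTerm σ z ∈ (layerLT σ w).chains k := by
    have := Submodule.sub_mem _ h (spinChain_sub_leadingTerm_mem hz)
    rwa [sub_sub_cancel] at this
  ext c
  by_contra hc
  have hcP := ((Finsupp.mem_supported ℤ z).1 hz (Finsupp.mem_support_iff.2 hc)).1
  refine expand_notMem_layerLT hcP
    ((Finsupp.mem_supported ℤ _).1 hl (Finsupp.mem_support_iff.2 ?_)).1
  rw [leadingTerm_apply_expand]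
  exact mul_ne_zero (Units.ne_zero _) hc

/-- A symbol outside `L(< σ)` is the leading term of a cell, hence differs from a signed spun cell
by a chain of `L(< σ)`. -/
theorem chains_layerLE_le (k : ℤ) : (layerLE σ w).chains k ≤ (layerLT σ w).chains k ⊔
    ((wheelPerm σ w).chains (k - spinDim σ)).map (spinChain (wheel σ)) := by
  rw [Subcomplex.chains, Finsupp.supported_eq_span_single, Submodule.span_le]
  rintro _ ⟨f, ⟨hf, hk⟩, rfl⟩
  by_cases hf' : f ∈ (layerLT σ w).cells
  · exact Submodule.mem_sup_left (Finsupp.single_mem_supported ℤ _ ⟨hf', hk⟩)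
  · obtain ⟨c, hc, rfl⟩ := exists_expand_eq hf hf'
    have hz : Finsupp.single c (spinSign σ c : ℤ) ∈ (wheelPerm σ w).chains (k - spinDim σ) :=
      Finsupp.single_mem_supported ℤ _ ⟨hc, (cellDim_expand _).1 hk⟩
    have h : leadingTerm σ (Finsupp.single c (spinSign σ c : ℤ)) =
        Finsupp.single (expand (wheel σ) c) 1 := by
      rw [leadingTerm, Finsupp.linearCombination_single, smul_smul, ← Units.val_mul,
        Int.units_mul_self, Units.val_one, one_smul]
    refine Submodule.mem_sup.2 ⟨_, Submodule.neg_mem _ (spinChain_sub_leadingTerm_mem hz), _,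
      Submodule.mem_map_of_mem hz, ?_⟩
    rw [h]
    abel

variable (σ w)

/-- The spinning map. -/
noncomputable def spinMap :
    shift (wheelPerm σ w).chainComplex (spinDim σ) ⟶ (layerLE σ w).chainComplex where
  f k := ModuleCat.ofHom ((spinChain (wheel σ)).restrict (spinChain_mem (w := w) (k := k)))
  comm' i j hij := by
    simp only [ComplexShape.down_Rel] at hij
    refine ModuleCat.hom_ext (LinearMap.ext fun z => Subtype.ext ?_)
    have hij' : (j - spinDim σ : ℤ) + 1 = i - spinDim σ := by omega
    simp only [Subcomplex.chainComplex, shift]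
    rw [dif_pos hij, dif_pos hij']
    exact boundary_spinChain (wheel σ) (wheel_ne_nil σ) fun c hc =>
      ((Finsupp.mem_supported ℤ _).1 z.2 hc).1.2.1

theorem isSpinningMap_spinMap : IsSpinningMap σ (spinMap σ w) := by
  refine ⟨spinSign σ, fun k z => ?_⟩
  simp only [spinCell_eq]
  exact spinChain_apply z.1

theorem spinMap_injective (k : ℤ) : Function.Injective ((spinMap σ w).f k).hom := by
  rw [injective_iff_map_eq_zero]
  intro z hz
  refine Subtype.ext (eq_zero_of_spinChain_mem (k := k) z.2 ?_)
  have : spinChain (wheel σ) z.1 = 0 := congrArg Subtype.val hz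
  rw [this]
  exact Submodule.zero_mem _

theorem bijective_coprod_spinMap (k : ℤ) : Function.Bijective (LinearMap.coprod
    (((layerLT σ w).inclusion (layerLE σ w) (layerLT_subset_layerLE σ w)).f k).hom
    ((spinMap σ w).f k).hom) := by
  constructor
  · rw [injective_iff_map_eq_zero]
    rintro ⟨y, z⟩ h
    have h' : y.1 + spinChain (wheel σ) z.1 = 0 := congrArg Subtype.val h
    have hz : z.1 = 0 := by
      refine eq_zero_of_spinChain_mem (k := k) z.2 ?_
      rw [eq_neg_of_add_eq_zero_right h']
      exact Submodule.neg_mem _ y.2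
    rw [hz, map_zero, add_zero] at h'
    exact Prod.ext (Subtype.ext h') (Subtype.ext hz)
  · intro x
    obtain ⟨y, hy, _, ⟨z, hz, rfl⟩, h⟩ := Submodule.mem_sup.1 (chains_layerLE_le k x.2)
    exact ⟨(⟨y, hy⟩, ⟨z, hz⟩), Subtype.ext h⟩

/-- The spinning map, as a map to the chains of `cel(n, w)`. -/
noncomputable abbrev spinMapCel :
    shift (wheelPerm σ w).chainComplex (spinDim σ) ⟶ (cel (Fin n) w).chainComplex :=
  spinMap σ w ≫ (layerLE σ w).inclusion (cel (Fin n) w) (layerLE_subset_cel σ w)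

variable (n)

theorem chains_layerLE_le_iSup (k : ℤ) : (layerLE σ w).chains k ≤
    ⨆ τ : Equiv.Perm (Fin n),
      ((wheelPerm τ w).chains (k - spinDim τ)).map (spinChain (wheel τ)) := by
  let r : Equiv.Perm (Fin n) → Lex (Fin n → Fin n) := fun τ => toLex (τ : Fin n → Fin n)
  -- Well-founded induction on the lexicographic order: every symbol of `L(< σ)` lies in some `L(≤
  -- τ)` with `τ < σ`.
  induction σ using (InvImage.wf r wellFounded_lt).induction with
  | _ σ ih =>
    refine (chains_layerLE_le k).trans (sup_le ?_ (le_iSup (fun τ : Equiv.Perm (Fin n) =>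
      ((wheelPerm τ w).chains (k - spinDim τ)).map (spinChain (wheel τ))) σ))
    rw [Subcomplex.chains, Finsupp.supported_eq_span_single, Submodule.span_le]
    rintro _ ⟨f, ⟨⟨hf, τ, hτ, hs⟩, hk⟩, rfl⟩
    exact ih τ (Set.mem_ofPred.1 hτ) (Finsupp.single_mem_supported ℤ _
      ⟨⟨hf, τ, Set.mem_ofPred.2 le_rfl, hs⟩, hk⟩)

theorem bijective_toModule_spinMapCel (k : ℤ) : Function.Bijective
    (DirectSum.toModule ℤ (Equiv.Perm (Fin n)) ((cel (Fin n) w).chainComplex.X k)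
      fun σ => ((spinMapCel σ w).f k).hom) := by
  classical
  constructor
  · rw [injective_iff_map_eq_zero]
    intro y hy
    by_contra hne
    -- In a vanishing sum of spun chains, all terms but that of the largest `σ` lie in `L(< σ)`. So
    -- does the term of `σ`, which forces its component to be zero.
    obtain ⟨σ, hσ, hmax⟩ := Finset.exists_max_image (DFinsupp.support y)
      (fun τ : Equiv.Perm (Fin n) => toLex (τ : Fin n → Fin n))
      (Finset.nonempty_iff_ne_empty.2 fun h => hne (DFinsupp.support_eq_empty.1 h))
    have hsum : ∑ τ ∈ DFinsupp.support y, spinChain (wheel τ) (y τ).1 = 0 := by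
      have h := congrArg (fun x : (cel (Fin n) w).chains k => x.1) hy
      rw [← DirectSum.sum_support_of y, map_sum] at h
      simp only [← DirectSum.lof_eq_of ℤ, DirectSum.toModule_lof] at h
      refine Eq.trans ?_ h
      exact (map_sum (Submodule.subtype ((cel (Fin n) w).chains k))
        (fun τ => (((spinMapCel τ w).f k).hom (y τ) : (cel (Fin n) w).chains k)) _).symm
    rw [← Finset.add_sum_erase _ _ hσ] at hsum
    refine DFinsupp.mem_support_iff.1 hσ (Subtype.ext ?_)
    refine eq_zero_of_spinChain_mem (k := k) (y σ).2 ?_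
    rw [eq_neg_of_add_eq_zero_left hsum]
    refine Submodule.neg_mem _ (Submodule.sum_mem _ fun τ hτ => ?_)
    obtain ⟨hne, hτ⟩ := Finset.mem_erase.1 hτ
    have hlt : toLex (τ : Fin n → Fin n) < toLex (σ : Fin n → Fin n) :=
      lt_of_le_of_ne (hmax τ hτ) fun h => hne (DFunLike.coe_injective (toLex.injective h))
    refine (?_ : (layerLE τ w).chains k ≤ (layerLT σ w).chains k) (spinChain_mem _ (y τ).2)
    refine Finsupp.supported_mono ?_
    rintro f ⟨⟨hf, ρ, hρ, hs⟩, hk⟩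
    exact ⟨⟨hf, ρ, Set.mem_ofPred.2 ((Set.mem_ofPred.1 hρ).trans_lt hlt), hs⟩, hk⟩
  · intro x
    suffices h : (cel (Fin n) w).chains k ≤ (LinearMap.range (DirectSum.toModule ℤ
        (Equiv.Perm (Fin n)) ((cel (Fin n) w).chainComplex.X k)
        fun σ => ((spinMapCel σ w).f k).hom)).map (Submodule.subtype ((cel (Fin n) w).chains k)) by
      obtain ⟨_, ⟨y, rfl⟩, hy⟩ := h x.2
      exact ⟨y, Subtype.ext hy⟩
    refine (Finsupp.supported_eq_span_single ℤ _).le.trans (Submodule.span_le.2 ?_)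
    rintro _ ⟨f, ⟨hf, hk⟩, rfl⟩
    obtain ⟨σ, hσ⟩ := exists_mem_layers hf
    refine (chains_layerLE_le_iSup n σ w k).trans (iSup_le fun τ => ?_)
      (Finsupp.single_mem_supported ℤ _ ⟨hσ, hk⟩)
    rintro _ ⟨z, hz, rfl⟩
    have h := DirectSum.toModule_lof ℤ (φ := fun σ : Equiv.Perm (Fin n) =>
      ((spinMapCel σ w).f k).hom) τ ⟨z, hz⟩
    exact ⟨_, ⟨DirectSum.lof ℤ _ (fun σ : Equiv.Perm (Fin n) =>
      (shift (wheelPerm σ w).chainComplex (spinDim σ)).X k) τ ⟨z, hz⟩, rfl⟩,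
      congrArg (fun x : (cel (Fin n) w).chains k => x.1) h⟩

end SpinMap

end StripCell

theorem mainTheorem3 (n w : ℕ) :
    (∀ j : ℤ, Nonempty
      ((cel (Fin n) w).chainComplex.homology j ≃ₗ[ℤ]
        ⨁ σ : Equiv.Perm (Fin n), (wheelPerm σ w).chainComplex.homology (j - spinDim σ))) ∧
    ∃ i : ∀ σ : Equiv.Perm (Fin n),
        shift (wheelPerm σ w).chainComplex (spinDim σ) ⟶ (layerLE σ w).chainComplex,
      (∀ σ, IsSpinningMap σ (i σ)) ∧
      (∀ σ (k : ℤ), Function.Injective ((i σ).f k).hom) ∧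
      (∀ σ (j : ℤ), Function.Bijective
        (LinearMap.coprod
          (HomologicalComplex.homologyMap
            ((layerLT σ w).inclusion (layerLE σ w) (layerLT_subset_layerLE σ w)) j).hom
          (HomologicalComplex.homologyMap (i σ) j).hom)) ∧
      (∀ j : ℤ, Function.Bijective
        (DirectSum.toModule ℤ (Equiv.Perm (Fin n)) ((cel (Fin n) w).chainComplex.homology j)
          (fun σ => (HomologicalComplex.homologyMap
            (i σ ≫ (layerLE σ w).inclusion (cel (Fin n) w) (layerLE_subset_cel σ w)) j).hom))) := by
  have hb := fun j => bijective_toModule_homologyMap (fun σ => spinMapCel σ w)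
    (bijective_toModule_spinMapCel n w) j
  refine ⟨fun j => ⟨?_⟩, fun σ => spinMap σ w, fun σ => isSpinningMap_spinMap σ w,
    fun σ k => spinMap_injective σ w k,
    fun σ j => bijective_coprod_homologyMap _ _ (bijective_coprod_spinMap σ w) j, hb⟩
  let e₁ := (AddEquiv.ofBijective (DirectSum.toModule ℤ (Equiv.Perm (Fin n))
    ((cel (Fin n) w).chainComplex.homology j)
    fun σ => (HomologicalComplex.homologyMap (spinMapCel σ w) j).hom).toAddMonoidHom (hb j)).symm
  let e₂ := DFinsupp.mapRange.addEquiv fun σ : Equiv.Perm (Fin n) =>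
    shiftHomologyEquiv (wheelPerm σ w).chainComplex (spinDim σ) j
  let e := e₁.trans e₂
  -- An additive equivalence is automatically `ℤ`-linear.
  exact { e with map_smul' := fun c x => map_intCast_smul e ℤ ℤ c x }
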